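/- Let $U\subseteq\mathbb{R}^n$ be open with coordinates $u=(u^1,\dots,u^n)$; summation over repeated indices is understood, and $\partial_s=\partial/\partial u^s$. An operator of type $(1+0)$ on $U$ is $$\mathcal{C}^{ij}=g^{ij}(u)\,\partial_x+b^{ij}_k(u)\,u^k_x+\omega^{ij}(u),$$ with first-order part $\mathcal{C}_{(1)}^{ij}=g^{ij}\partial_x+b^{ij}_ku^k_x$. It is called Hamiltonian if $$\{F,G\}_{\mathcal C}=\int \frac{\delta F}{\delta u^i}\,\mathcal{C}^{ij}\,\frac{\delta G}{\delta u^j}\,dx$$ is skew-symmetric and satisfies the Jacobi identity on all local functionals $F=\int f\,dx$, where the density $f$ is a smooth function of $x$, of $u\in U$ and of finitely many $x$-derivatives of $u$, and where functionals are identified when their densities differ by a total $x$-derivative of such a function. Two operators $\mathcal A,\mathcal B$ are compatible if $\mu\mathcal A+\lambda\mathcal B$ is Hamiltonian for all $\mu,\lambda\in\mathbb{R}$. Let $\eta=(\eta^{ij})$ be a constant symmetric matrix with $\det\eta\neq0$, let $c^{ij}_k,f^{ij}\in\mathbb{R}$ be constants, and let $$\mathcal A^{ij}=\eta^{ij}\partial_x+\omega_{\mathcal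 A}^{ij},\qquad \omega^{ij}_{\mathcal A}=c^{ij}_k u^k+f^{ij},$$ be Hamiltonian (a non-degenerate operator in flat, i.e. Darboux, coordinates). Let $h^1,\dots,h^n$ and $\omega_{\mathcal B}^{ij}$ be smooth functions on $U$, and let $$\mathcal B^{ij}=\left(\eta^{is}\partial_s h^j+\eta^{js}\partial_s h^i\right)\partial_x+\eta^{is}\,\partial_s\partial_k h^j\,u^k_x+\omega_{\mathcal B}^{ij}.$$ Assume that $\mathcal B$ is Hamiltonian whenever its first-order part $\mathcal B_{(1)}$ is (this holds in particular if $\mathcal B$ is Hamiltonian, but the Hamiltonian property of $\mathcal B_{(1)}$ is not presupposed). Then $\mathcal A$ and $\mathcal B$ are compatible if and only if the following expressions vanish identically on $U$ for all values of the indices: $$G^{ijk}=\left(\eta^{ip}\partial_p h^\ell+\eta^{\ell p}\partial_p h^i\right)\eta^{js}\,\partial_s\partial_\ell h^k-\left(\eta^{jp}\partial_p h^\ell+\eta^{\ell p}\partial_p h^j\right)\eta^{is}\,\partial_s\partial_\ell h^k,$$ $$R^{jr}_{sk}=\partial_s\partial_\ell h^j\,\eta^{\ell m}\,\partial_m\partial_k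 h^r-\partial_s\partial_\ell h^r\,\eta^{\ell m}\,\partial_m\partial_k h^j,$$ $$L^{ijk}=c^{ij}_p\,\omega_{\mathcal B}^{pk}+\partial_p\omega_{\mathcal B}^{ij}\,\omega_{\mathcal A}^{pk}+c^{jk}_p\,\omega_{\mathcal B}^{pi}+\partial_p\omega_{\mathcal B}^{jk}\,\omega_{\mathcal A}^{pi}+c^{ki}_p\,\omega_{\mathcal B}^{pj}+\partial_p\omega_{\mathcal B}^{ki}\,\omega_{\mathcal A}^{pj},$$ $$\begin{aligned}P^{ijk}={}&\eta^{is}\partial_s\omega_{\mathcal B}^{jk}+\left(\eta^{i\ell}\partial_\ell h^s+\eta^{s\ell}\partial_\ell h^i\right)c^{jk}_s-\eta^{i\ell}\,\partial_\ell\partial_s h^j\,\omega_{\mathcal A}^{sk}-\eta^{i\ell}\,\partial_\ell\partial_s h^k\,\omega_{\mathcal A}^{js}\\&+\eta^{js}\partial_s\omega_{\mathcal B}^{ik}+\left(\eta^{j\ell}\partial_\ell h^s+\eta^{s\ell}\partial_\ell h^j\right)c^{ik}_s-\eta^{j\ell}\,\partial_\ell\partial_s h^i\,\omega_{\mathcal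 A}^{sk}-\eta^{j\ell}\,\partial_\ell\partial_s h^k\,\omega_{\mathcal A}^{is},\end{aligned}$$ $$\begin{aligned}S^{jk}_{ir}={}&\partial_i\partial_r\omega_{\mathcal B}^{jk}+\partial_i\partial_r h^s\,c^{jk}_s+\partial_i\partial_s h^k\,c^{sj}_r+\partial_s\partial_r h^k\,c^{sj}_i-\partial_s\partial_r h^j\,c^{sk}_i-\partial_i\partial_s h^j\,c^{sk}_r\\&-\partial_i\partial_s\partial_r h^j\,\omega_{\mathcal A}^{sk}-\partial_i\partial_s\partial_r h^k\,\omega_{\mathcal A}^{js}.\end{aligned}$$ -/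

import Mathlib

open scoped ContDiff

noncomputable section

namespace HydroPair

/-- Points of the infinite jet space of `n` field variables depending on one independent variable
`x`: a value of `x` together with the values `u^i_{(k)}` (`k`-th `x`-derivative of `u^i`),
stored as `z.2 k i`. -/
abbrev Jet (n : ℕ) : Type := ℝ × (ℕ → Fin n → ℝ)

/-- `f` is a differential function (density) over the open set `U` of field values: a smooth
function of `x` and of finitely many of the jet variables, with `u ∈ U`. -/
def IsDiffFun {n : ℕ} (U : Set (Fin n → ℝ)) (f : Jet n → ℝ) : Prop :=
  ∃ (N : ℕ) (F : ℝ × (Fin (N + 1) → Fin n → ℝ) → ℝ),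
    ContDiffOn ℝ ∞ F {q | q.2 0 ∈ U} ∧
    ∀ z : Jet n, z.2 0 ∈ U → f z = F (z.1, fun k => z.2 (k : ℕ))

/-- `∂f/∂u^i_{(k)}`. -/
def jetDeriv {n : ℕ} (k : ℕ) (i : Fin n) (f : Jet n → ℝ) : Jet n → ℝ := fun z =>
  deriv (fun t : ℝ => f (z.1, Function.update z.2 k (Function.update (z.2 k) i t))) (z.2 k i)

/-- The total derivative `D_x f = ∂f/∂x + ∑ u^i_{(k+1)} ∂f/∂u^i_{(k)}`.
For a differential function only finitely many terms are nonzero. -/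
def totalDeriv {n : ℕ} (f : Jet n → ℝ) : Jet n → ℝ := fun z =>
  deriv (fun y : ℝ => f (y, z.2)) z.1
    + ∑ᶠ k : ℕ, ∑ i : Fin n, z.2 (k + 1) i * jetDeriv k i f z

/-- The variational derivative `δF/δu^i = ∑_k (-D_x)^k (∂f/∂u^i_{(k)})` of `F = ∫ f dx`. -/
def varDeriv {n : ℕ} (f : Jet n → ℝ) (i : Fin n) : Jet n → ℝ := fun z =>
  ∑ᶠ k : ℕ, (-1 : ℝ) ^ k * (totalDeriv^[k] (jetDeriv k i f)) z

/-- `∫ f dx = 0` as a local functional: `f` is a total derivative. -/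
def IsNullFunctional {n : ℕ} (U : Set (Fin n → ℝ)) (f : Jet n → ℝ) : Prop :=
  ∃ h : Jet n → ℝ, IsDiffFun U h ∧ ∀ z : Jet n, z.2 0 ∈ U → f z = totalDeriv h z

/-- The coefficients of an operator of type `1+0`,
`g^{ij}(u) ∂_x + b^{ij}_k(u) u^k_x + w^{ij}(u)`. -/
structure Op (n : ℕ) where
  /-- `g i j` is `g^{ij}` -/
  g : Fin n → Fin n → (Fin n → ℝ) → ℝ
  /-- `b i j k` is `b^{ij}_k` -/
  b : Fin n → Fin n → Fin n → (Fin n → ℝ) → ℝ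
  /-- `w i j` is `w^{ij}` -/
  w : Fin n → Fin n → (Fin n → ℝ) → ℝ

namespace Op

/-- The value `C^{ij} ξ_j` of the operator on a tuple of differential functions. -/
def apply {n : ℕ} (C : Op n) (ξ : Fin n → Jet n → ℝ) (i : Fin n) : Jet n → ℝ := fun z =>
  ∑ j, (C.g i j (z.2 0) * totalDeriv (ξ j) z
    + (∑ k, C.b i j k (z.2 0) * z.2 1 k) * ξ j z
    + C.w i j (z.2 0) * ξ j z)

/-- The density `(δF/δu^i) C^{ij} (δG/δu^j)` of the bracket `{F, G}_C`
of `F = ∫ f dx` and `G = ∫ g dx`. -/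
def bracket {n : ℕ} (C : Op n) (f g : Jet n → ℝ) : Jet n → ℝ := fun z =>
  ∑ i, varDeriv f i z * C.apply (varDeriv g) i z

/-- `C` is Hamiltonian over `U`: its bracket on local functionals is skew-symmetric and
satisfies the Jacobi identity. -/
def IsHamiltonian {n : ℕ} (U : Set (Fin n → ℝ)) (C : Op n) : Prop :=
  (∀ f g : Jet n → ℝ, IsDiffFun U f → IsDiffFun U g →
    IsNullFunctional U (fun z => C.bracket f g z + C.bracket g f z)) ∧
  (∀ f g h : Jet n → ℝ, IsDiffFun U f → IsDiffFun U g → IsDiffFun U h →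
    IsNullFunctional U (fun z => C.bracket (C.bracket f g) h z
      + C.bracket (C.bracket g h) f z + C.bracket (C.bracket h f) g z))

/-- The linear combination `μ A + ν B`. -/
def lincomb {n : ℕ} (μ : ℝ) (A : Op n) (ν : ℝ) (B : Op n) : Op n where
  g i j u := μ * A.g i j u + ν * B.g i j u
  b i j k u := μ * A.b i j k u + ν * B.b i j k u
  w i j u := μ * A.w i j u + ν * B.w i j u

/-- `A` and `B` are compatible: every linear combination of them is Hamiltonian. -/
def Compatible {n : ℕ} (U : Set (Fin n → ℝ)) (A B : Op n) : Prop :=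
  ∀ μ ν : ℝ, IsHamiltonian U (lincomb μ A ν B)

/-- The homogeneous first-order part `C_(1)` of the operator `C`. -/
def firstOrder {n : ℕ} (C : Op n) : Op n where
  g := C.g
  b := C.b
  w _ _ _ := 0

end Op

/-- `∂φ/∂u^s` for a function of the field variables. -/
def pd {n : ℕ} (s : Fin n) (φ : (Fin n → ℝ) → ℝ) : (Fin n → ℝ) → ℝ := fun u =>
  fderiv ℝ φ u (Pi.single s 1)

/-- The tensor `c^{ij}_k u^k + f^{ij}` (with `c i j k` for `c^{ij}_k`). -/
def affineTensor {n : ℕ} (c : Fin n → Fin n → Fin n → ℝ) (f : Fin n → Fin n → ℝ)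
    (i j : Fin n) : (Fin n → ℝ) → ℝ := fun u => ∑ k, c i j k * u k + f i j

/-- `A^{ij} = η^{ij} ∂_x + c^{ij}_k u^k + f^{ij}`. -/
def darbouxOp {n : ℕ} (η : Matrix (Fin n) (Fin n) ℝ) (c : Fin n → Fin n → Fin n → ℝ)
    (f : Fin n → Fin n → ℝ) : Op n where
  g i j _ := η i j
  b _ _ _ _ := 0
  w := affineTensor c f

/-- `η^{is} ∂h^j/∂u^s + η^{js} ∂h^i/∂u^s`. -/
def mokhovMetric {n : ℕ} (η : Matrix (Fin n) (Fin n) ℝ) (h : Fin n → (Fin n → ℝ) → ℝ)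
    (i j : Fin n) : (Fin n → ℝ) → ℝ := fun u =>
  ∑ s, (η i s * pd s (h j) u + η j s * pd s (h i) u)

/-- `η^{is} ∂²h^j/∂u^s∂u^k`. -/
def mokhovConn {n : ℕ} (η : Matrix (Fin n) (Fin n) ℝ) (h : Fin n → (Fin n → ℝ) → ℝ)
    (i j k : Fin n) : (Fin n → ℝ) → ℝ := fun u =>
  ∑ s, η i s * pd s (pd k (h j)) u

/-- `B^{ij} = (η^{is} ∂_s h^j + η^{js} ∂_s h^i) ∂_x + η^{is} ∂_s ∂_k h^j u^k_x + w^{ij}`. -/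
def mokhovOp {n : ℕ} (η : Matrix (Fin n) (Fin n) ℝ) (h : Fin n → (Fin n → ℝ) → ℝ)
    (w : Fin n → Fin n → (Fin n → ℝ) → ℝ) : Op n where
  g := mokhovMetric η h
  b := mokhovConn η h
  w := w

/-- `G^{ijk}`. -/
def tensorG {n : ℕ} (η : Matrix (Fin n) (Fin n) ℝ) (h : Fin n → (Fin n → ℝ) → ℝ)
    (i j k : Fin n) (u : Fin n → ℝ) : ℝ :=
  ∑ l, ∑ s, (∑ p, (η i p * pd p (h l) u + η l p * pd p (h i) u))
      * η j s * pd s (pd l (h k)) u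
  - ∑ l, ∑ s, (∑ p, (η j p * pd p (h l) u + η l p * pd p (h j) u))
      * η i s * pd s (pd l (h k)) u

/-- `R^{jr}_{sk}`. -/
def tensorR {n : ℕ} (η : Matrix (Fin n) (Fin n) ℝ) (h : Fin n → (Fin n → ℝ) → ℝ)
    (j r s k : Fin n) (u : Fin n → ℝ) : ℝ :=
  ∑ l, ∑ m, (pd s (pd l (h j)) u * η l m * pd m (pd k (h r)) u
    - pd s (pd l (h r)) u * η l m * pd m (pd k (h j)) u)

/-- `L^{ijk}`; here `w` is the zero-order part of `B`. -/
def tensorL {n : ℕ} (c : Fin n → Fin n → Fin n → ℝ) (f : Fin n → Fin n → ℝ)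
    (w : Fin n → Fin n → (Fin n → ℝ) → ℝ) (i j k : Fin n) (u : Fin n → ℝ) : ℝ :=
  ∑ p, (c i j p * w p k u + pd p (w i j) u * (∑ s, c p k s * u s + f p k)
    + c j k p * w p i u + pd p (w j k) u * (∑ s, c p i s * u s + f p i)
    + c k i p * w p j u + pd p (w k i) u * (∑ s, c p j s * u s + f p j))

/-- `P^{ijk}`. -/
def tensorP {n : ℕ} (η : Matrix (Fin n) (Fin n) ℝ) (c : Fin n → Fin n → Fin n → ℝ)
    (f : Fin n → Fin n → ℝ) (h : Fin n → (Fin n → ℝ) → ℝ)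
    (w : Fin n → Fin n → (Fin n → ℝ) → ℝ) (i j k : Fin n) (u : Fin n → ℝ) : ℝ :=
  ∑ s, (η i s * pd s (w j k) u
    + (∑ l, (η i l * pd l (h s) u + η s l * pd l (h i) u)) * c j k s
    - (∑ l, η i l * pd l (pd s (h j)) u) * (∑ m, c s k m * u m + f s k)
    - (∑ l, η i l * pd l (pd s (h k)) u) * (∑ m, c j s m * u m + f j s)
    + η j s * pd s (w i k) u
    + (∑ l, (η j l * pd l (h s) u + η s l * pd l (h j) u)) * c i k s
    - (∑ l, η j l * pd l (pd s (h i)) u) * (∑ m, c s k m * u m + f s k)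
    - (∑ l, η j l * pd l (pd s (h k)) u) * (∑ m, c i s m * u m + f i s))

/-- `S^{jk}_{ir}`. -/
def tensorS {n : ℕ} (c : Fin n → Fin n → Fin n → ℝ)
    (f : Fin n → Fin n → ℝ) (h : Fin n → (Fin n → ℝ) → ℝ)
    (w : Fin n → Fin n → (Fin n → ℝ) → ℝ) (j k i r : Fin n) (u : Fin n → ℝ) : ℝ :=
  pd i (pd r (w j k)) u
    + ∑ s, (pd i (pd r (h s)) u * c j k s
      + pd i (pd s (h k)) u * c s j r
      + pd s (pd r (h k)) u * c s j i
      - pd s (pd r (h j)) u * c s k i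
      - pd i (pd s (h j)) u * c s k r
      - pd i (pd s (pd r (h j))) u * (∑ m, c s k m * u m + f s k)
      - pd i (pd s (pd r (h k))) u * (∑ m, c j s m * u m + f j s))

end HydroPair

end

/-! For a skew-adjoint operator `C`, the bracket with a functional is differentiation along an
evolutionary field. In the cyclic Jacobi sum the derivatives of the variational derivatives `ξ, η,
χ` along these fields cancel modulo total derivatives, because the linearization of a variational
derivative is self-adjoint (`helmholtz`). What remains is the cyclic sum of `ξ (v_Q C) η` with `Q =
C χ` (`jacobi_sub_mem_null`), which integration by parts brings to the trilinear normal form `cyc`.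

Densities may depend on `x`, so powers of `x - c`, and their multiples by `u^l`, occur as single
components of variational derivatives. Inserting them shows that the coefficients of the normal form
must satisfy the identities `Conditions`, which are also sufficient (`isHam_iff`). Comparing
coefficients of `u_x` and `u_xx` turns them into identities between functions of `u`
(`isHamiltonian_iff_pointConditions`). The argument needs no nondegenerate metric, only that `g` is
symmetric, `∂_k g^{ij} = b^{ij}_k + b^{ji}_k` and `∂_s b^{ij}_k = ∂_k b^{ij}_s`. These relations are
linear and hold for `A` and `B`, hence for all their combinations.

Apart from the linear skewness of `w`, the identities are homogeneous quadratic in the operator.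
Compatibility of a Hamiltonian `A` with `B` therefore means that `B` is Hamiltonian and that the
polarized identities hold (`compatible_iff`). In Darboux coordinates two of the polarized identities
are automatic and the others amount to `L = P = S = 0` (`mixedConditions_iff`), while `G = R = 0`
expresses the Hamiltonian property of the first-order part of `B`. By hypothesis the latter already
makes `B` Hamiltonian. Invertibility of `η` removes the contractions with `η` that appear for `R`
and `S`. -/

noncomputable section

namespace HydroPair

/-! ### Evolutionary fields, the Euler operator and the Jacobi expression in an abstract jet
algebra. -/

section

/-- A differential algebra with jet coordinates: a derivation `D` (total derivative), derivations
`p k i` (partial derivatives by `u^i_{(k)}`) and coordinates `u i`. -/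
structure JetAlgebra (ι A : Type*) [DecidableEq ι] [CommRing A] [Algebra ℝ A] where
  D : Derivation ℝ A A
  p : ℕ → ι → Derivation ℝ A A
  u : ι → A
  p_comm : ∀ k i l j a, p k i (p l j a) = p l j (p k i a)
  p_zero_D : ∀ i a, p 0 i (D a) = D (p 0 i a)
  p_succ_D : ∀ k i a, p (k + 1) i (D a) = D (p (k + 1) i a) + p k i a
  exists_order : ∀ a, ∃ N, ∀ k, N ≤ k → ∀ i, p k i a = 0
  p_zero_u : ∀ i j, p 0 i (u j) = if i = j then 1 else 0
  p_succ_u : ∀ k i j, p (k + 1) i (u j) = 0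

namespace JetAlgebra

variable {ι A : Type*} [Fintype ι] [DecidableEq ι] [CommRing A] [Algebra ℝ A]
  (𝒥 : JetAlgebra ι A)

/-- `N` bounds the order of `a`. -/
def OrderLE (a : A) (N : ℕ) : Prop := ∀ k, N ≤ k → ∀ i, 𝒥.p k i a = 0

variable {𝒥} in
omit [Fintype ι] in
theorem OrderLE.mono {a : A} {N M : ℕ} (h : 𝒥.OrderLE a N) (hNM : N ≤ M) : 𝒥.OrderLE a M :=
  fun k hk i => h k (hNM.trans hk) i

/-- A bound for the order of `a`. -/
def order (a : A) : ℕ := (𝒥.exists_order a).choose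

omit [Fintype ι] in
theorem orderLE_order (a : A) : 𝒥.OrderLE a (𝒥.order a) := (𝒥.exists_order a).choose_spec

/-- Iterated total derivatives, as linear maps. -/
abbrev Dp (k : ℕ) : Module.End ℝ A := (𝒥.D : Module.End ℝ A) ^ k

omit [Fintype ι] in
theorem Dp_succ (k : ℕ) (a : A) : 𝒥.Dp (k + 1) a = 𝒥.D (𝒥.Dp k a) := by
  simp [Dp, pow_succ']

omit [Fintype ι] in
theorem Dp_succ' (k : ℕ) (a : A) : 𝒥.Dp (k + 1) a = 𝒥.Dp k (𝒥.D a) := by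
  simp [Dp, pow_succ]

/-- Elements that are total derivatives. -/
def null : Submodule ℝ A := LinearMap.range (𝒥.D : A →ₗ[ℝ] A)

omit [Fintype ι] in
theorem D_mem_null (a : A) : 𝒥.D a ∈ 𝒥.null := ⟨a, rfl⟩

/-- `order` is some chosen bound, not the minimal one. Terms beyond any bound vanish, so sums over
several elements can be given a common range. -/
theorem sum_order_eq {M : Type*} [AddCommMonoid M] {a : A} {N : ℕ} (hN : 𝒥.OrderLE a N)
    (F : ℕ → ι → A → M) (hF : ∀ k i, F k i 0 = 0) :
    ∑ k ∈ Finset.range (𝒥.order a), ∑ i, F k i (𝒥.p k i a)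
      = ∑ k ∈ Finset.range N, ∑ i, F k i (𝒥.p k i a) := by
  have key : ∀ {N M : ℕ}, N ≤ M → 𝒥.OrderLE a N →
      ∑ k ∈ Finset.range N, ∑ i, F k i (𝒥.p k i a)
        = ∑ k ∈ Finset.range M, ∑ i, F k i (𝒥.p k i a) := by
    intro N M hNM h
    refine Finset.sum_subset (Finset.range_mono hNM) fun k _ hk => ?_
    refine Finset.sum_eq_zero fun i _ => ?_
    rw [h k (by simpa using hk) i, hF]
  rw [key (le_max_left _ N) (𝒥.orderLE_order a), key (le_max_right (𝒥.order a) N) hN]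

/-- The prolongation of the evolutionary vector field with characteristic `Q`, as a function. -/
def prolFun (Q : ι → A) (a : A) : A :=
  ∑ k ∈ Finset.range (𝒥.order a), ∑ i, 𝒥.Dp k (Q i) * 𝒥.p k i a

theorem prolFun_eq (Q : ι → A) {a : A} {N : ℕ} (hN : 𝒥.OrderLE a N) :
    𝒥.prolFun Q a = ∑ k ∈ Finset.range N, ∑ i, 𝒥.Dp k (Q i) * 𝒥.p k i a :=
  𝒥.sum_order_eq hN (fun k i x => 𝒥.Dp k (Q i) * x) (by simp)

omit [Fintype ι] in
theorem exists_orderLE₃ (a b c : A) : ∃ N, 𝒥.OrderLE a N ∧ 𝒥.OrderLE b N ∧ 𝒥.OrderLE c N :=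
  ⟨max (𝒥.order a) (max (𝒥.order b) (𝒥.order c)),
    (𝒥.orderLE_order a).mono (by simp), (𝒥.orderLE_order b).mono (by simp),
    (𝒥.orderLE_order c).mono (by simp)⟩

/-- The prolongation of the evolutionary vector field with characteristic `Q`. -/
def prol (Q : ι → A) : Derivation ℝ A A :=
  Derivation.mk'
    { toFun := 𝒥.prolFun Q
      map_add' := fun a b => by
        obtain ⟨N, ha, hb, hc⟩ := 𝒥.exists_orderLE₃ a b (a + b)
        rw [𝒥.prolFun_eq Q ha, 𝒥.prolFun_eq Q hb, 𝒥.prolFun_eq Q hc]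
        simp [mul_add, Finset.sum_add_distrib]
      map_smul' := fun r a => by
        obtain ⟨N, ha, hc, -⟩ := 𝒥.exists_orderLE₃ a (r • a) 0
        rw [𝒥.prolFun_eq Q ha, 𝒥.prolFun_eq Q hc]
        simp [Finset.smul_sum] }
    (fun a b => by
      obtain ⟨N, ha, hb, hc⟩ := 𝒥.exists_orderLE₃ a b (a * b)
      simp only [LinearMap.coe_mk, AddHom.coe_mk]
      rw [𝒥.prolFun_eq Q ha, 𝒥.prolFun_eq Q hb, 𝒥.prolFun_eq Q hc]
      simp only [Derivation.leibniz, smul_eq_mul, Finset.mul_sum, ← Finset.sum_add_distrib]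
      exact Finset.sum_congr rfl fun k _ => Finset.sum_congr rfl fun i _ => by ring)

theorem prol_eq (Q : ι → A) {a : A} {N : ℕ} (hN : 𝒥.OrderLE a N) :
    𝒥.prol Q a = ∑ k ∈ Finset.range N, ∑ i, 𝒥.Dp k (Q i) * 𝒥.p k i a :=
  𝒥.prolFun_eq Q hN

theorem prol_u (Q : ι → A) (j : ι) : 𝒥.prol Q (𝒥.u j) = Q j := by
  have h : 𝒥.OrderLE (𝒥.u j) 1 := by
    intro k hk i
    obtain ⟨m, rfl⟩ := Nat.exists_eq_add_of_le' hk
    exact 𝒥.p_succ_u m i j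
  rw [𝒥.prol_eq Q h]
  simp [𝒥.p_zero_u]

/-- The extra term `p k i a` of `p_succ_D` comes multiplied by `Dp (k + 1) (Q i)`, which is what `D`
produces when it falls on `Dp k (Q i)`. -/
theorem prol_D (Q : ι → A) (a : A) : 𝒥.prol Q (𝒥.D a) = 𝒥.D (𝒥.prol Q a) := by
  obtain ⟨N, ha, hb, -⟩ := 𝒥.exists_orderLE₃ a (𝒥.D a) 0
  rw [𝒥.prol_eq Q ha, 𝒥.prol_eq Q (hb.mono N.le_succ)]
  rw [Finset.sum_range_succ']
  simp only [𝒥.p_zero_D, 𝒥.p_succ_D, mul_add, Finset.sum_add_distrib, map_sum,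
    Derivation.leibniz, smul_eq_mul]
  have h1 : ∑ k ∈ Finset.range N, ∑ i, 𝒥.Dp k (Q i) * 𝒥.D (𝒥.p k i a)
      = ∑ k ∈ Finset.range N, ∑ i, 𝒥.Dp (k + 1) (Q i) * 𝒥.D (𝒥.p (k + 1) i a)
        + ∑ i, 𝒥.Dp 0 (Q i) * 𝒥.D (𝒥.p 0 i a) := by
    rw [← Finset.sum_range_succ' (fun k => ∑ i, 𝒥.Dp k (Q i) * 𝒥.D (𝒥.p k i a)),
      Finset.sum_range_succ]
    simp [ha N le_rfl]
  rw [h1]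
  simp only [𝒥.Dp_succ, mul_comm]
  ring

theorem prol_Dp (Q : ι → A) (k : ℕ) (a : A) : 𝒥.prol Q (𝒥.Dp k a) = 𝒥.Dp k (𝒥.prol Q a) := by
  induction k with
  | zero => simp
  | succ k ih => rw [𝒥.Dp_succ, 𝒥.prol_D, ih, 𝒥.Dp_succ]

theorem prol_mem_null (Q : ι → A) {a : A} (ha : a ∈ 𝒥.null) : 𝒥.prol Q a ∈ 𝒥.null := by
  obtain ⟨b, rfl⟩ := ha
  exact ⟨𝒥.prol Q b, (𝒥.prol_D Q b).symm⟩

/-- The parts with second partial derivatives of `a` agree since the `p k i` commute, so only the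
first-order parts survive. -/
theorem prol_commutator (P Q : ι → A) (a : A) :
    𝒥.prol P (𝒥.prol Q a) - 𝒥.prol Q (𝒥.prol P a)
      = 𝒥.prol (fun i => 𝒥.prol P (Q i) - 𝒥.prol Q (P i)) a := by
  have ho : 𝒥.OrderLE a (𝒥.order a) := 𝒥.orderLE_order a
  have hop : ∀ k i, 𝒥.OrderLE (𝒥.p k i a) (𝒥.order a) := fun k i l hl j => by
    rw [𝒥.p_comm, ho l hl j, map_zero]
  have key : ∀ P Q : ι → A, 𝒥.prol P (𝒥.prol Q a)
      = (∑ k ∈ Finset.range (𝒥.order a), ∑ i, 𝒥.Dp k (𝒥.prol P (Q i)) * 𝒥.p k i a)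
        + ∑ k ∈ Finset.range (𝒥.order a), ∑ i, ∑ l ∈ Finset.range (𝒥.order a), ∑ j,
            𝒥.Dp k (Q i) * 𝒥.Dp l (P j) * 𝒥.p l j (𝒥.p k i a) := by
    intro P Q
    rw [𝒥.prol_eq Q ho]
    simp only [map_sum, Derivation.leibniz, smul_eq_mul, 𝒥.prol_Dp, Finset.sum_add_distrib]
    rw [add_comm]
    congr 1
    · simp only [mul_comm]
    · refine Finset.sum_congr rfl fun k _ => Finset.sum_congr rfl fun i _ => ?_
      rw [𝒥.prol_eq P (hop k i)]
      simp only [Finset.mul_sum, mul_assoc]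
  have hsymm : (∑ k ∈ Finset.range (𝒥.order a), ∑ i, ∑ l ∈ Finset.range (𝒥.order a), ∑ j,
            𝒥.Dp k (Q i) * 𝒥.Dp l (P j) * 𝒥.p l j (𝒥.p k i a))
      = ∑ k ∈ Finset.range (𝒥.order a), ∑ i, ∑ l ∈ Finset.range (𝒥.order a), ∑ j,
            𝒥.Dp k (P i) * 𝒥.Dp l (Q j) * 𝒥.p l j (𝒥.p k i a) := by
    have hq : ∀ G : ℕ → ι → ℕ → ι → A, ∑ k ∈ Finset.range (𝒥.order a), ∑ i,
          ∑ l ∈ Finset.range (𝒥.order a), ∑ j, G k i l j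
        = ∑ k ∈ Finset.range (𝒥.order a), ∑ i,
          ∑ l ∈ Finset.range (𝒥.order a), ∑ j, G l j k i := by
      intro G
      simp only [← Finset.sum_product' (Finset.range (𝒥.order a)) Finset.univ]
      exact Finset.sum_comm
    rw [hq]
    refine Finset.sum_congr rfl fun k _ => Finset.sum_congr rfl fun i _ =>
      Finset.sum_congr rfl fun l _ => Finset.sum_congr rfl fun j _ => ?_
    rw [𝒥.p_comm]
    ring
  rw [key, key, hsymm, 𝒥.prol_eq _ ho]
  simp only [map_sub, sub_mul, Finset.sum_sub_distrib]
  ring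

/-- The Euler operator (variational derivative). -/
def euler (i : ι) (a : A) : A :=
  ∑ k ∈ Finset.range (𝒥.order a), (-1 : ℝ) ^ k • 𝒥.Dp k (𝒥.p k i a)

omit [Fintype ι] in
theorem euler_eq (i : ι) {a : A} {N : ℕ} (hN : 𝒥.OrderLE a N) :
    𝒥.euler i a = ∑ k ∈ Finset.range N, (-1 : ℝ) ^ k • 𝒥.Dp k (𝒥.p k i a) := by
  have key : ∀ {N M : ℕ}, N ≤ M → 𝒥.OrderLE a N →
      ∑ k ∈ Finset.range N, (-1 : ℝ) ^ k • 𝒥.Dp k (𝒥.p k i a)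
        = ∑ k ∈ Finset.range M, (-1 : ℝ) ^ k • 𝒥.Dp k (𝒥.p k i a) := by
    intro N M hNM h
    refine Finset.sum_subset (Finset.range_mono hNM) fun k _ hk => ?_
    rw [h k (by simpa using hk) i]
    simp
  rw [euler, key (le_max_left _ N) (𝒥.orderLE_order a), key (le_max_right (𝒥.order a) N) hN]

-- The sum telescopes: the extra term of `p_succ_D` at level `k + 1` cancels the total derivative at
-- level `k` by the alternating sign.
omit [Fintype ι] in
theorem euler_D (i : ι) (a : A) : 𝒥.euler i (𝒥.D a) = 0 := by
  obtain ⟨N, ha, hb, -⟩ := 𝒥.exists_orderLE₃ a (𝒥.D a) 0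
  rw [𝒥.euler_eq i (hb.mono N.le_succ), Finset.sum_range_succ']
  simp only [𝒥.p_zero_D, 𝒥.p_succ_D, map_add, smul_add, Finset.sum_add_distrib]
  have h1 : ∑ k ∈ Finset.range N, (-1 : ℝ) ^ k • 𝒥.Dp (k + 1) (𝒥.p k i a)
      = ∑ k ∈ Finset.range N, (-1 : ℝ) ^ (k + 1) • 𝒥.Dp (k + 1) (𝒥.D (𝒥.p (k + 1) i a))
        + (-1 : ℝ) ^ 0 • 𝒥.Dp 0 (𝒥.D (𝒥.p 0 i a)) := by
    rw [← Finset.sum_range_succ' (fun k => (-1 : ℝ) ^ k • 𝒥.Dp k (𝒥.D (𝒥.p k i a))),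
      Finset.sum_range_succ]
    simp [ha N le_rfl, 𝒥.Dp_succ']
  have h2 : ∑ k ∈ Finset.range N, (-1 : ℝ) ^ (k + 1) • 𝒥.Dp (k + 1) (𝒥.p k i a)
      = - ∑ k ∈ Finset.range N, (-1 : ℝ) ^ k • 𝒥.Dp (k + 1) (𝒥.p k i a) := by
    rw [← Finset.sum_neg_distrib]
    refine Finset.sum_congr rfl fun k _ => ?_
    rw [pow_succ]; simp
  rw [h2, h1]
  abel

omit [Fintype ι] in
theorem euler_eq_zero_of_mem_null (i : ι) {a : A} (ha : a ∈ 𝒥.null) : 𝒥.euler i a = 0 := by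
  obtain ⟨b, rfl⟩ := ha
  exact 𝒥.euler_D i b

omit [Fintype ι] in
theorem Dp_mul_sub_mem_null (k : ℕ) (a b : A) :
    𝒥.Dp k a * b - a * ((-1 : ℝ) ^ k • 𝒥.Dp k b) ∈ 𝒥.null := by
  induction k generalizing b with
  | zero => simp
  | succ k ih =>
    have h1 := 𝒥.D_mem_null (𝒥.Dp k a * b)
    have h2 := ih (𝒥.D b)
    have := Submodule.sub_mem _ h1 h2
    convert this using 1
    rw [𝒥.Dp_succ, 𝒥.Dp_succ', Derivation.leibniz, pow_succ]
    simp only [smul_eq_mul, mul_neg, mul_one, neg_smul]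
    ring

/-- The first variation formula: each `D^k` is moved off `Q i` by parts. -/
theorem prol_sub_mem_null (Q : ι → A) (a : A) :
    𝒥.prol Q a - ∑ i, Q i * 𝒥.euler i a ∈ 𝒥.null := by
  rw [𝒥.prol_eq Q (𝒥.orderLE_order a)]
  simp only [euler, Finset.mul_sum]
  rw [Finset.sum_comm, ← Finset.sum_sub_distrib]
  refine Submodule.sum_mem _ fun i _ => ?_
  rw [← Finset.sum_sub_distrib]
  exact Submodule.sum_mem _ fun k _ => 𝒥.Dp_mul_sub_mem_null k _ _

/-- The linearization of a variational derivative is formally self-adjoint. -/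
theorem helmholtz (P Q : ι → A) (a : A) :
    ∑ i, Q i * 𝒥.prol P (𝒥.euler i a) - ∑ i, P i * 𝒥.prol Q (𝒥.euler i a) ∈ 𝒥.null := by
  -- The first variation formula is differentiated along the other field. The two second variations
  -- differ by a commutator, to which the formula applies once more in `h3`.
  have h1 := 𝒥.prol_mem_null P (𝒥.prol_sub_mem_null Q a)
  have h2 := 𝒥.prol_mem_null Q (𝒥.prol_sub_mem_null P a)
  have h3 := 𝒥.prol_sub_mem_null (fun i => 𝒥.prol P (Q i) - 𝒥.prol Q (P i)) a
  rw [← 𝒥.prol_commutator] at h3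
  have h4 := Submodule.add_mem _ (Submodule.sub_mem _ h2 h1) h3
  convert h4 using 1
  simp only [map_sub, map_sum, Derivation.leibniz, smul_eq_mul, Finset.sum_add_distrib, mul_sub,
    Finset.sum_sub_distrib, mul_comm]
  ring

/-- The operator `g^{ij} D + β^{ij}`. -/
def opApply (g β : ι → ι → A) (ξ : ι → A) (i : ι) : A :=
  ∑ j, (g i j * 𝒥.D (ξ j) + β i j * ξ j)

/-- The bracket density of the operator `g^{ij} D + β^{ij}`. -/
def opBracket (g β : ι → ι → A) (a b : A) : A :=
  ∑ i, 𝒥.euler i a * 𝒥.opApply g β (fun j => 𝒥.euler j b) i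

/-- Skew-adjointness: the sum is the total derivative of `g^{ij} ξ_i η_j`, with `hβ` accounting for
the derivative of `g`. -/
theorem opApply_add_mem_null {g β : ι → ι → A} (hg : ∀ i j, g i j = g j i)
    (hβ : ∀ i j, 𝒥.D (g i j) = β i j + β j i) (ξ η : ι → A) :
    ∑ i, ξ i * 𝒥.opApply g β η i + ∑ i, η i * 𝒥.opApply g β ξ i ∈ 𝒥.null := by
  refine ⟨∑ i, ∑ j, g i j * (ξ i * η j), ?_⟩
  have : ∑ i, η i * 𝒥.opApply g β ξ i
      = ∑ i, ∑ j, η j * (g j i * 𝒥.D (ξ i) + β j i * ξ i) := by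
    simp only [opApply, Finset.mul_sum]
    exact Finset.sum_comm
  rw [this]
  simp only [opApply, Finset.mul_sum, ← Finset.sum_add_distrib, Derivation.coeFn_coe, map_sum]
  refine Finset.sum_congr rfl fun i _ => Finset.sum_congr rfl fun j _ => ?_
  simp only [Derivation.leibniz, smul_eq_mul, hβ i j, hg j i]
  ring

/-- The pairing `ξ_i (v_Q C)^{ij} η_j`, where `v_Q C` is the operator `C = g D + β`
differentiated along `Q`. -/
def opDeriv (g β : ι → ι → A) (Q ξ η : ι → A) : A :=
  ∑ i, ∑ j, ξ i * (𝒥.prol Q (g i j) * 𝒥.D (η j) + 𝒥.prol Q (β i j) * η j)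

/-- By the first variation formula, bracketing with `c` is differentiation along `Q`. The Leibniz
rule gives three terms, and skew-adjointness moves the operator off the derivative of `η`. -/
theorem bracket_bracket_sub_mem_null {g β : ι → ι → A} (hg : ∀ i j, g i j = g j i)
    (hβ : ∀ i j, 𝒥.D (g i j) = β i j + β j i) (a b c : A) :
    let ξ := fun i => 𝒥.euler i a
    let η := fun i => 𝒥.euler i b
    let Q := 𝒥.opApply g β fun i => 𝒥.euler i c
    𝒥.opBracket g β (𝒥.opBracket g β a b) c
      - (∑ i, 𝒥.opApply g β η i * 𝒥.prol Q (ξ i) - ∑ i, 𝒥.opApply g β ξ i * 𝒥.prol Q (η i)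
        + 𝒥.opDeriv g β Q ξ η) ∈ 𝒥.null := by
  intro ξ η Q
  have h1 := 𝒥.prol_sub_mem_null Q (𝒥.opBracket g β a b)
  have h2 := 𝒥.opApply_add_mem_null hg hβ ξ (fun j => 𝒥.prol Q (η j))
  have h3 : 𝒥.prol Q (𝒥.opBracket g β a b)
      = ∑ i, 𝒥.opApply g β η i * 𝒥.prol Q (ξ i)
        + ∑ i, ξ i * 𝒥.opApply g β (fun j => 𝒥.prol Q (η j)) i
        + 𝒥.opDeriv g β Q ξ η := by
    simp only [opBracket, map_sum, Derivation.leibniz, smul_eq_mul, Finset.sum_add_distrib]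
    rw [add_comm, add_assoc]
    congr 1
    simp only [opApply, opDeriv, Finset.mul_sum, ← Finset.sum_add_distrib, map_sum, map_add,
      Derivation.leibniz, smul_eq_mul, 𝒥.prol_D]
    exact Finset.sum_congr rfl fun i _ => Finset.sum_congr rfl fun j _ => by ring
  have h4 := Submodule.sub_mem _ h2 h1
  convert h4 using 1
  have h5 : 𝒥.opBracket g β (𝒥.opBracket g β a b) c
      = ∑ i, Q i * 𝒥.euler i (𝒥.opBracket g β a b) := by
    rw [opBracket]
    exact Finset.sum_congr rfl fun i _ => mul_comm _ _
  rw [h3, h5]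
  simp only [mul_comm]
  ring

/-- The Jacobi expression of a skew-adjoint operator depends on the densities only through their
variational derivatives, up to total derivatives. -/
theorem jacobi_sub_mem_null {g β : ι → ι → A} (hg : ∀ i j, g i j = g j i)
    (hβ : ∀ i j, 𝒥.D (g i j) = β i j + β j i) (a b c : A) :
    let ξ := fun i => 𝒥.euler i a
    let η := fun i => 𝒥.euler i b
    let χ := fun i => 𝒥.euler i c
    (𝒥.opBracket g β (𝒥.opBracket g β a b) c + 𝒥.opBracket g β (𝒥.opBracket g β b c) a
      + 𝒥.opBracket g β (𝒥.opBracket g β c a) b)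
      - (𝒥.opDeriv g β (𝒥.opApply g β χ) ξ η + 𝒥.opDeriv g β (𝒥.opApply g β ξ) η χ
        + 𝒥.opDeriv g β (𝒥.opApply g β η) χ ξ) ∈ 𝒥.null := by
  intro ξ η χ
  have h1 := 𝒥.bracket_bracket_sub_mem_null hg hβ a b c
  have h2 := 𝒥.bracket_bracket_sub_mem_null hg hβ b c a
  have h3 := 𝒥.bracket_bracket_sub_mem_null hg hβ c a b
  -- In the cyclic sum each of `ξ, η, χ` is differentiated along two fields with opposite signs;
  -- self-adjointness cancels each pair.
  have k1 := 𝒥.helmholtz (𝒥.opApply g β χ) (𝒥.opApply g β η) a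
  have k2 := 𝒥.helmholtz (𝒥.opApply g β ξ) (𝒥.opApply g β χ) b
  have k3 := 𝒥.helmholtz (𝒥.opApply g β η) (𝒥.opApply g β ξ) c
  have := Submodule.add_mem _ (Submodule.add_mem _ (Submodule.add_mem _ (Submodule.add_mem _
    (Submodule.add_mem _ h1 h2) h3) k1) k2) k3
  convert this using 1
  simp only [ξ, η, χ]
  ring

end JetAlgebra

end

/-! ### Normal form of the Jacobi expression and sufficiency of the coefficient identities. -/

section

namespace JetAlgebra

variable {ι A : Type*} [Fintype ι] [DecidableEq ι] [CommRing A] [Algebra ℝ A]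
  (𝒥 : JetAlgebra ι A)

/-- `a` depends on the field variables only. -/
structure IsPoint (a : A) : Prop where
  p_succ : ∀ k s, 𝒥.p (k + 1) s a = 0
  D_eq : 𝒥.D a = ∑ s, 𝒥.D (𝒥.u s) * 𝒥.p 0 s a

theorem IsPoint.prol_eq {𝒥 : JetAlgebra ι A} {a : A} (ha : 𝒥.IsPoint a) (Q : ι → A) :
    𝒥.prol Q a = ∑ s, Q s * 𝒥.p 0 s a := by
  have h : 𝒥.OrderLE a 1 := by
    intro k hk i
    obtain ⟨m, rfl⟩ := Nat.exists_eq_add_of_le' hk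
    exact ha.p_succ m i
  rw [𝒥.prol_eq Q h]
  simp

/-- Coefficients of an operator `g^{ij} D + b^{ij}_k u^k_x + w^{ij}` with `g` symmetric,
`∂_k g^{ij} = b^{ij}_k + b^{ji}_k` and `∂_s b^{ij}_k = ∂_k b^{ij}_s`. -/
structure Coeffs where
  g : ι → ι → A
  b : ι → ι → ι → A
  w : ι → ι → A
  g_point : ∀ i j, 𝒥.IsPoint (g i j)
  b_point : ∀ i j k, 𝒥.IsPoint (b i j k)
  w_point : ∀ i j, 𝒥.IsPoint (w i j)
  g_symm : ∀ i j, g i j = g j i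
  g_deriv : ∀ i j k, 𝒥.p 0 k (g i j) = b i j k + b j i k
  b_closed : ∀ i j k s, 𝒥.p 0 s (b i j k) = 𝒥.p 0 k (b i j s)

namespace Coeffs

variable {𝒥} (C : 𝒥.Coeffs)

/-- The part `b^{ij}_k u^k_x + w^{ij}` of order zero as a differential operator. -/
def β (i j : ι) : A := ∑ k, C.b i j k * 𝒥.D (𝒥.u k) + C.w i j

/-- `g^{sl} b^{ij}_s`. -/
def gb (l i j : ι) : A := ∑ s, C.g s l * C.b i j s

/-- `g^{sl} ∂_s w^{ij}`. -/
def gw (l i j : ι) : A := ∑ s, C.g s l * 𝒥.p 0 s (C.w i j)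

/-- `β^{sl} b^{ij}_s`. -/
def βb (l i j : ι) : A := ∑ s, C.β s l * C.b i j s

/-- `β^{sl} ∂_s w^{ij}`. -/
def βw (l i j : ι) : A := ∑ s, C.β s l * 𝒥.p 0 s (C.w i j)

/-- `g^{js} ∂_s w^{li} + β^{sl} b^{ji}_s - β^{si} b^{jl}_s`. -/
def K (j l i : ι) : A := C.gw j l i + C.βb l j i - C.βb i j l

theorem D_g (hw : ∀ i j, C.w i j + C.w j i = 0) (i j : ι) :
    𝒥.D (C.g i j) = C.β i j + C.β j i := by
  rw [(C.g_point i j).D_eq]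
  have : C.β i j + C.β j i = ∑ k, C.b i j k * 𝒥.D (𝒥.u k) + ∑ k, C.b j i k * 𝒥.D (𝒥.u k)
      + (C.w i j + C.w j i) := by simp only [β]; ring
  rw [this, hw, add_zero, ← Finset.sum_add_distrib]
  exact Finset.sum_congr rfl fun k _ => by rw [C.g_deriv]; ring

theorem prol_g (Q : ι → A) (i j : ι) :
    𝒥.prol Q (C.g i j) = ∑ s, Q s * (C.b i j s + C.b j i s) := by
  rw [(C.g_point i j).prol_eq]
  exact Finset.sum_congr rfl fun s _ => by rw [C.g_deriv]

/-- Because `b^{ij}_k` is closed in `k`, the variation of `b^{ij}_k u^k_x` is a full total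
derivative, ready for integration by parts. -/
theorem prol_β (Q : ι → A) (i j : ι) :
    𝒥.prol Q (C.β i j) = 𝒥.D (∑ s, C.b i j s * Q s) + ∑ s, Q s * 𝒥.p 0 s (C.w i j) := by
  simp only [β, map_add, map_sum, Derivation.leibniz, smul_eq_mul, 𝒥.prol_D, 𝒥.prol_u,
    (C.w_point i j).prol_eq, (C.b_point i j _).prol_eq, (C.b_point i j _).D_eq,
    Finset.sum_add_distrib]
  congr 2
  simp only [Finset.mul_sum]
  rw [Finset.sum_comm]
  refine Finset.sum_congr rfl fun k _ => Finset.sum_congr rfl fun s _ => ?_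
  rw [C.b_closed i j s k]
  ring

/-- `b^{ji}_s ξ_i η_j' - b^{ij}_s ξ_i' η_j + ∂_s w^{ij} ξ_i η_j`. -/
def covector (ξ η : ι → A) (s : ι) : A :=
  ∑ i, ∑ j, (C.b j i s * (ξ i * 𝒥.D (η j)) - C.b i j s * (𝒥.D (ξ i) * η j)
    + 𝒥.p 0 s (C.w i j) * (ξ i * η j))

theorem opDeriv_sub_mem_null (Q ξ η : ι → A) :
    𝒥.opDeriv C.g C.β Q ξ η - ∑ s, Q s * C.covector ξ η s ∈ 𝒥.null := by
  -- The term `D (b^{ij}_s Q^s)` of `prol_β` is integrated by parts so that `Q` stays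
  -- undifferentiated; this cancels the `b^{ij}_s` half of `∂_s g^{ij}`.
  refine ⟨∑ i, ∑ j, ξ i * η j * ∑ s, C.b i j s * Q s, ?_⟩
  have h : ∑ s, Q s * C.covector ξ η s = ∑ i, ∑ j, ∑ s, Q s *
      (C.b j i s * (ξ i * 𝒥.D (η j)) - C.b i j s * (𝒥.D (ξ i) * η j)
        + 𝒥.p 0 s (C.w i j) * (ξ i * η j)) := by
    simp only [covector, Finset.mul_sum]
    rw [Finset.sum_comm]
    exact Finset.sum_congr rfl fun i _ => Finset.sum_comm
  rw [h]
  simp only [opDeriv, Derivation.coeFn_coe, map_sum, ← Finset.sum_sub_distrib]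
  refine Finset.sum_congr rfl fun i _ => Finset.sum_congr rfl fun j _ => ?_
  rw [C.prol_g, C.prol_β, Derivation.leibniz, Derivation.leibniz]
  set b' := 𝒥.D (∑ s, C.b i j s * Q s)
  simp only [smul_eq_mul, Finset.mul_sum, mul_add, mul_sub, Finset.sum_add_distrib,
    Finset.sum_sub_distrib, add_mul, Finset.sum_mul]
  have e : ∀ f g : ι → A, (∀ s, f s = g s) → ∑ s, f s = ∑ s, g s :=
    fun f g h => Finset.sum_congr rfl fun s _ => h s
  rw [e (fun s => ξ i * (Q s * C.b j i s * 𝒥.D (η j))) (fun s => Q s * (C.b j i s * (ξ i * 𝒥.D (η j))))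
      fun s => by ring,
    e (fun s => ξ i * (Q s * 𝒥.p 0 s (C.w i j) * η j))
      (fun s => Q s * (𝒥.p 0 s (C.w i j) * (ξ i * η j))) fun s => by ring,
    e (fun s => C.b i j s * Q s * (ξ i * 𝒥.D (η j)))
      (fun s => ξ i * (Q s * C.b i j s * 𝒥.D (η j))) fun s => by ring,
    e (fun s => C.b i j s * Q s * (η j * 𝒥.D (ξ i)))
      (fun s => Q s * (C.b i j s * (𝒥.D (ξ i) * η j))) fun s => by ring]
  ring

/-- Coefficient of the normal form of `opDeriv` with respect to components `x, y, z`
of `ξ, η, χ` with indices `i, j, l`. -/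
def cell (i j l : ι) (x y z : A) : A :=
  C.gb l j i * (x * 𝒥.D y * 𝒥.D z) - C.gb l i j * (𝒥.D x * y * 𝒥.D z)
    + C.gw l i j * (x * y * 𝒥.D z) + C.βb l j i * (x * 𝒥.D y * z)
    - C.βb l i j * (𝒥.D x * y * z) + C.βw l i j * (x * y * z)

theorem sum_opApply_mul_covector (ξ η χ : ι → A) :
    ∑ s, 𝒥.opApply C.g C.β χ s * C.covector ξ η s
      = ∑ i, ∑ j, ∑ l, C.cell i j l (ξ i) (η j) (χ l) := by
  have h : ∑ s, 𝒥.opApply C.g C.β χ s * C.covector ξ η s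
      = ∑ i, ∑ j, ∑ l, ∑ s, (C.g s l * 𝒥.D (χ l) + C.β s l * χ l) *
      (C.b j i s * (ξ i * 𝒥.D (η j)) - C.b i j s * (𝒥.D (ξ i) * η j)
        + 𝒥.p 0 s (C.w i j) * (ξ i * η j)) := by
    simp only [covector, opApply, Finset.mul_sum]
    rw [Finset.sum_comm]
    refine Finset.sum_congr rfl fun i _ => ?_
    rw [Finset.sum_comm]
    refine Finset.sum_congr rfl fun j _ => ?_
    rw [Finset.sum_comm]
    simp only [Finset.sum_mul]
  rw [h]
  refine Finset.sum_congr rfl fun i _ => Finset.sum_congr rfl fun j _ =>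
    Finset.sum_congr rfl fun l _ => ?_
  simp only [cell, gb, gw, βb, βw, Finset.sum_mul, ← Finset.sum_add_distrib,
    ← Finset.sum_sub_distrib]
  exact Finset.sum_congr rfl fun s _ => by ring

/-- Cyclic sum of the coefficients `cell`. -/
def cyc (i j l : ι) (x y z : A) : A :=
  C.cell i j l x y z + C.cell j l i y z x + C.cell l i j z x y

theorem sum_cyc (ξ η χ : ι → A) :
    ∑ i, ∑ j, ∑ l, C.cyc i j l (ξ i) (η j) (χ l)
      = ∑ i, ∑ j, ∑ l, C.cell i j l (ξ i) (η j) (χ l)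
        + ∑ i, ∑ j, ∑ l, C.cell i j l (η i) (χ j) (ξ l)
        + ∑ i, ∑ j, ∑ l, C.cell i j l (χ i) (ξ j) (η l) := by
  have h : ∀ F : ι → ι → ι → A, ∑ i, ∑ j, ∑ l, F j l i = ∑ i, ∑ j, ∑ l, F i j l := by
    intro F
    rw [Finset.sum_comm]
    exact Finset.sum_congr rfl fun i _ => Finset.sum_comm
  rw [← h fun i j l => C.cell i j l (η i) (χ j) (ξ l),
    ← h fun i j l => C.cell i j l (χ i) (ξ j) (η l),
    ← h fun i j l => C.cell j l i (χ j) (ξ l) (η i)]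
  simp only [cyc, Finset.sum_add_distrib]

/-- The bracket density defined by the coefficients. -/
def bracket (a b : A) : A := 𝒥.opBracket C.g C.β a b

theorem jacobi_sub_sum_cyc_mem_null (hw : ∀ i j, C.w i j + C.w j i = 0) (a b c : A) :
    (C.bracket (C.bracket a b) c + C.bracket (C.bracket b c) a + C.bracket (C.bracket c a) b)
      - ∑ i, ∑ j, ∑ l, C.cyc i j l (𝒥.euler i a) (𝒥.euler j b) (𝒥.euler l c) ∈ 𝒥.null := by
  have h0 := 𝒥.jacobi_sub_mem_null C.g_symm (C.D_g hw) a b c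
  have h1 := C.opDeriv_sub_mem_null (𝒥.opApply C.g C.β fun i => 𝒥.euler i c)
    (fun i => 𝒥.euler i a) (fun i => 𝒥.euler i b)
  have h2 := C.opDeriv_sub_mem_null (𝒥.opApply C.g C.β fun i => 𝒥.euler i a)
    (fun i => 𝒥.euler i b) (fun i => 𝒥.euler i c)
  have h3 := C.opDeriv_sub_mem_null (𝒥.opApply C.g C.β fun i => 𝒥.euler i b)
    (fun i => 𝒥.euler i c) (fun i => 𝒥.euler i a)
  rw [C.sum_opApply_mul_covector] at h1 h2 h3
  have := Submodule.add_mem _ (Submodule.add_mem _ (Submodule.add_mem _ h0 h1) h2) h3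
  convert this using 1
  rw [C.sum_cyc (fun i => 𝒥.euler i a) (fun i => 𝒥.euler i b) (fun i => 𝒥.euler i c)]
  simp only [bracket]
  ring

/-- Sorted by monomials: differences of `gb` go with two derivatives, `K` with one, and the cyclic
sum of `βw` with none. -/
theorem cyc_eq (i j l : ι) (x y z : A) :
    C.cyc i j l x y z
      = (C.gb l j i - C.gb j l i) * (x * 𝒥.D y * 𝒥.D z)
        + (C.gb i l j - C.gb l i j) * (y * 𝒥.D z * 𝒥.D x)
        + (C.gb j i l - C.gb i j l) * (z * 𝒥.D x * 𝒥.D y)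
        + C.K j l i * (x * 𝒥.D y * z) + C.K l i j * (x * y * 𝒥.D z)
        + C.K i j l * (𝒥.D x * y * z)
        + (C.βw l i j + C.βw i j l + C.βw j l i) * (x * y * z) := by
  simp only [cyc, cell, K]
  ring

/-- The conditions on the coefficients equivalent to the Hamiltonian property. -/
structure Conditions : Prop where
  w_skew : ∀ i j, C.w i j + C.w j i = 0
  gb_symm : ∀ l j i, C.gb l j i = C.gb j l i
  K_cyclic : ∀ j l i, C.K j l i = C.K l i j
  D_K : ∀ i j l, 𝒥.D (C.K i j l) = C.βw l i j + C.βw i j l + C.βw j l i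

/-- The Hamiltonian property on the level of the differential algebra. -/
structure IsHam : Prop where
  skew : ∀ a b, C.bracket a b + C.bracket b a ∈ 𝒥.null
  jacobi : ∀ a b c, C.bracket (C.bracket a b) c + C.bracket (C.bracket b c) a
    + C.bracket (C.bracket c a) b ∈ 𝒥.null

variable {C} in
theorem Conditions.isHam (h : C.Conditions) : C.IsHam where
  skew a b := 𝒥.opApply_add_mem_null C.g_symm (C.D_g h.w_skew) _ _
  jacobi a b c := by
    have h1 := C.jacobi_sub_sum_cyc_mem_null h.w_skew a b c
    refine (Submodule.sub_mem_iff_left _ ?_).mp h1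
    -- Under the conditions the quadratic derivative terms vanish, the three `K` coefficients
    -- coincide, and each summand is the total derivative of `K^{ijl} ξ_i η_j χ_l`.
    refine Submodule.sum_mem _ fun i _ => Submodule.sum_mem _ fun j _ =>
      Submodule.sum_mem _ fun l _ => ⟨C.K i j l *
        (𝒥.euler i a * 𝒥.euler j b * 𝒥.euler l c), ?_⟩
    rw [C.cyc_eq, h.gb_symm l j i, h.gb_symm i l j, h.gb_symm j i l, h.K_cyclic l i j,
      h.K_cyclic j l i, h.K_cyclic l i j, ← h.D_K]
    simp only [Derivation.coeFn_coe, Derivation.leibniz, smul_eq_mul]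
    ring

end Coeffs

end JetAlgebra

end

/-! ### Differential functions as smooth functions on finite jet spaces. -/

section

variable {n : ℕ}

/-- Jets of order at most `N`. -/
abbrev FinJet (n N : ℕ) : Type := ℝ × (Fin (N + 1) → Fin n → ℝ)

/-- Truncation of an infinite jet. -/
def proj (N : ℕ) (z : Jet n) : FinJet n N := (z.1, fun k => z.2 (k : ℕ))

/-- Finite jets over `U`. -/
def finDomain (U : Set (Fin n → ℝ)) (N : ℕ) : Set (FinJet n N) := {q | q.2 0 ∈ U}

theorem isOpen_finDomain {U : Set (Fin n → ℝ)} (hU : IsOpen U) (N : ℕ) :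
    IsOpen (finDomain U N) :=
  hU.preimage ((continuous_apply 0).comp continuous_snd)

/-- `f` is represented over `U` by the smooth function `F` on jets of order `N`. -/
structure HasRep (U : Set (Fin n → ℝ)) (f : Jet n → ℝ) (N : ℕ) (F : FinJet n N → ℝ) : Prop where
  smooth : ContDiffOn ℝ ∞ F (finDomain U N)
  eq : ∀ z : Jet n, z.2 0 ∈ U → f z = F (proj N z)

theorem isDiffFun_iff {U : Set (Fin n → ℝ)} {f : Jet n → ℝ} :
    IsDiffFun U f ↔ ∃ N F, HasRep U f N F :=
  ⟨fun ⟨N, F, h1, h2⟩ => ⟨N, F, h1, h2⟩, fun ⟨N, F, h⟩ => ⟨N, F, h.1, h.2⟩⟩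

/-- Truncation of finite jets. -/
def trunc {N M : ℕ} (h : N ≤ M) : FinJet n M →L[ℝ] FinJet n N :=
  (ContinuousLinearMap.fst ℝ _ _).prod
    (ContinuousLinearMap.pi fun m =>
      (ContinuousLinearMap.proj (Fin.castLE (Nat.succ_le_succ h) m)).comp
        (ContinuousLinearMap.snd ℝ _ _))

theorem trunc_proj {N M : ℕ} (h : N ≤ M) (z : Jet n) : trunc h (proj M z) = proj N z := rfl

theorem trunc_mem {U : Set (Fin n → ℝ)} {N M : ℕ} (h : N ≤ M) {q : FinJet n M}
    (hq : q ∈ finDomain U M) : trunc h q ∈ finDomain U N := hq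

/-- The shift `u_{(k)} ↦ u_{(k+1)}` of finite jets. -/
def shift (N : ℕ) : FinJet n (N + 1) →L[ℝ] FinJet n N :=
  (0 : FinJet n (N + 1) →L[ℝ] ℝ).prod
    (ContinuousLinearMap.pi fun m =>
      (ContinuousLinearMap.proj m.succ).comp (ContinuousLinearMap.snd ℝ _ _))

/-- The coordinate direction `∂/∂u^i_{(k)}`. -/
def dir (N k : ℕ) (i : Fin n) : FinJet n N :=
  (0, fun m => if (m : ℕ) = k then Pi.single i 1 else 0)

theorem dir_eq_zero {N k : ℕ} (h : N < k) (i : Fin n) : dir N k i = 0 := by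
  refine Prod.ext rfl (funext fun m => ?_)
  have : (m : ℕ) ≠ k := by have := m.isLt; omega
  simp [dir, this]

namespace HasRep

variable {U : Set (Fin n → ℝ)} {f : Jet n → ℝ} {N : ℕ} {F : FinJet n N → ℝ}

theorem isDiffFun (h : HasRep U f N F) : IsDiffFun U f := ⟨N, F, h.1, h.2⟩

theorem contDiffAt (hU : IsOpen U) (h : HasRep U f N F) {q : FinJet n N}
    (hq : q ∈ finDomain U N) : ContDiffAt ℝ ∞ F q :=
  h.smooth.contDiffAt ((isOpen_finDomain hU N).mem_nhds hq)

theorem differentiableAt (hU : IsOpen U) (h : HasRep U f N F) {q : FinJet n N}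
    (hq : q ∈ finDomain U N) : DifferentiableAt ℝ F q :=
  (h.contDiffAt hU hq).differentiableAt (by simp)

theorem contDiffOn_fderiv (hU : IsOpen U) (h : HasRep U f N F) :
    ContDiffOn ℝ ∞ (fderiv ℝ F) (finDomain U N) :=
  h.smooth.fderiv_of_isOpen (isOpen_finDomain hU N) (by simp)

theorem raise (h : HasRep U f N F) {M : ℕ} (hNM : N ≤ M) : HasRep U f M (F ∘ trunc hNM) where
  smooth := h.smooth.comp (trunc hNM).contDiff.contDiffOn fun _ hq => trunc_mem hNM hq
  eq z hz := h.eq z hz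

/-- Outside the jets over `U` nothing is known about `f`. Openness of `U` keeps the curve over `U`
near `t`, where `f` may be replaced by its representative. -/
theorem hasDerivAt_comp (hU : IsOpen U) (h : HasRep U f N F) {γ : ℝ → Jet n} {t : ℝ}
    {v : FinJet n N} (hγ : HasDerivAt (fun s => proj N (γ s)) v t) (h0 : (γ t).2 0 ∈ U) :
    HasDerivAt (fun s => f (γ s)) (fderiv ℝ F (proj N (γ t)) v) t := by
  have h1 := (h.differentiableAt hU (q := proj N (γ t)) h0).hasFDerivAt.comp_hasDerivAt t hγ
  refine h1.congr_of_eventuallyEq ?_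
  have hc : ∀ᶠ s in nhds t, proj N (γ s) ∈ finDomain U N :=
    hγ.continuousAt.eventually ((isOpen_finDomain hU N).mem_nhds h0)
  exact hc.mono fun s hs => h.eq _ hs

theorem jetDeriv_eq (hU : IsOpen U) (h : HasRep U f N F) (k : ℕ) (i : Fin n) {z : Jet n}
    (hz : z.2 0 ∈ U) : jetDeriv k i f z = fderiv ℝ F (proj N z) (dir N k i) := by
  set γ : ℝ → Jet n := fun t => (z.1, Function.update z.2 k (Function.update (z.2 k) i t))
  have hγ0 : γ (z.2 k i) = z := by simp [γ]
  have hγ : HasDerivAt (fun s => proj N (γ s)) (dir N k i) (z.2 k i) := by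
    refine (hasDerivAt_const _ _).prodMk (hasDerivAt_pi.2 fun m => ?_)
    by_cases hm : (m : ℕ) = k
    · simp only [hm, if_true, γ, Function.update_self]
      exact hasDerivAt_update (z.2 k) i _
    · simp only [hm, if_false, γ, Function.update_of_ne hm]
      exact hasDerivAt_const _ _
  have := (h.hasDerivAt_comp hU hγ (by rwa [hγ0])).deriv
  rw [hγ0] at this
  exact this

theorem totalDeriv_eq (hU : IsOpen U) (h : HasRep U f N F) {z : Jet n} (hz : z.2 0 ∈ U) :
    totalDeriv f z = fderiv ℝ F (proj N z) ((1, 0) + shift N (proj (N + 1) z)) := by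
  have h1 : deriv (fun y : ℝ => f (y, z.2)) z.1 = fderiv ℝ F (proj N z) (1, 0) := by
    have hγ : HasDerivAt (fun s : ℝ => proj N ((s, z.2) : Jet n)) (1, 0) z.1 :=
      (hasDerivAt_id _).prodMk (hasDerivAt_const z.1 fun k : Fin (N + 1) => z.2 (k : ℕ))
    exact (h.hasDerivAt_comp hU hγ hz).deriv
  have h2 : ∑ᶠ k : ℕ, ∑ i : Fin n, z.2 (k + 1) i * jetDeriv k i f z
      = ∑ k ∈ Finset.range (N + 1), ∑ i : Fin n, z.2 (k + 1) i * jetDeriv k i f z := by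
    refine finsum_eq_sum_of_support_subset _ fun k hk => ?_
    by_contra hk'
    simp only [Finset.coe_range, Set.mem_Iio, not_lt] at hk'
    refine hk (Finset.sum_eq_zero fun i _ => ?_)
    rw [h.jetDeriv_eq hU k i hz, dir_eq_zero hk', map_zero, mul_zero]
  have h3 : shift N (proj (N + 1) z)
      = ∑ k ∈ Finset.range (N + 1), ∑ i : Fin n, z.2 (k + 1) i • dir N k i := by
    refine Prod.ext (by simp [shift, dir, Prod.fst_sum]) (funext fun m => funext fun j => ?_)
    have hm : (m : ℕ) < N + 1 := m.isLt
    simp [shift, dir, proj, Prod.snd_sum, Finset.sum_apply, Pi.single_apply,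
      Finset.sum_ite_eq, hm, Finset.sum_comm (s := Finset.range (N + 1))]
  rw [totalDeriv, h1, h2, map_add, h3]
  simp only [map_sum, map_smul, smul_eq_mul, h.jetDeriv_eq hU _ _ hz]

theorem jetDeriv (hU : IsOpen U) (h : HasRep U f N F) (k : ℕ) (i : Fin n) :
    HasRep U (jetDeriv k i f) N (fun q => fderiv ℝ F q (dir N k i)) where
  smooth := (h.contDiffOn_fderiv hU).clm_apply contDiffOn_const
  eq _ hz := h.jetDeriv_eq hU k i hz

theorem totalDeriv (hU : IsOpen U) (h : HasRep U f N F) :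
    HasRep U (totalDeriv f) (N + 1)
      (fun q => fderiv ℝ F (trunc N.le_succ q) ((1, 0) + shift N q)) where
  smooth := ((h.contDiffOn_fderiv hU).comp (trunc N.le_succ).contDiff.contDiffOn
    fun _ hq => trunc_mem _ hq).clm_apply
      (contDiff_const.add (shift N).contDiff).contDiffOn
  eq _ hz := h.totalDeriv_eq hU hz

theorem congr (h : HasRep U f N F) {g : Jet n → ℝ} (hg : ∀ z : Jet n, z.2 0 ∈ U → g z = f z) :
    HasRep U g N F := ⟨h.smooth, fun z hz => (hg z hz).trans (h.eq z hz)⟩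

theorem jetDeriv_comm (hU : IsOpen U) (h : HasRep U f N F) (k l : ℕ) (i j : Fin n) {z : Jet n}
    (hz : z.2 0 ∈ U) : HydroPair.jetDeriv k i (HydroPair.jetDeriv l j f) z
      = HydroPair.jetDeriv l j (HydroPair.jetDeriv k i f) z := by
  rw [(h.jetDeriv hU l j).jetDeriv_eq hU k i hz, (h.jetDeriv hU k i).jetDeriv_eq hU l j hz]
  have hd : DifferentiableAt ℝ (fderiv ℝ F) (proj N z) :=
    ((h.contDiffOn_fderiv hU).contDiffAt ((isOpen_finDomain hU N).mem_nhds hz)).differentiableAt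
      (by simp)
  have hs : IsSymmSndFDerivAt ℝ F (proj N z) :=
    (h.contDiffAt hU hz).isSymmSndFDerivAt (by simpa using WithTop.coe_le_coe.2 (le_top : (2 : ℕ∞) ≤ ⊤))
  rw [fderiv_clm_apply hd (by fun_prop), fderiv_clm_apply hd (by fun_prop)]
  simpa using hs.eq _ _

/-- The total derivative is the derivative along the field `(1, 0) + shift`, which is affine in the
jet. Its commutator with a coordinate direction is therefore the derivative along the image of that
direction under `shift`. -/
theorem jetDeriv_totalDeriv (hU : IsOpen U) (h : HasRep U f N F) (k : ℕ) (i : Fin n) {z : Jet n}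
    (hz : z.2 0 ∈ U) : HydroPair.jetDeriv k i (HydroPair.totalDeriv f) z
      = HydroPair.totalDeriv (HydroPair.jetDeriv k i f) z
        + fderiv ℝ F (proj N z) (shift N (dir (N + 1) k i)) := by
  rw [(h.totalDeriv hU).jetDeriv_eq hU k i hz, (h.jetDeriv hU k i).totalDeriv_eq hU hz]
  have hd : DifferentiableAt ℝ (fderiv ℝ F) (proj N z) :=
    ((h.contDiffOn_fderiv hU).contDiffAt ((isOpen_finDomain hU N).mem_nhds hz)).differentiableAt
      (by simp)
  have hd' : DifferentiableAt ℝ (fun q => fderiv ℝ F (trunc N.le_succ q)) (proj (N + 1) z) :=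
    DifferentiableAt.comp (proj (N + 1) z) hd (trunc N.le_succ).differentiableAt
  have hs : IsSymmSndFDerivAt ℝ F (proj N z) :=
    (h.contDiffAt hU hz).isSymmSndFDerivAt (by simpa using WithTop.coe_le_coe.2 (le_top : (2 : ℕ∞) ≤ ⊤))
  have hsh : HasFDerivAt (fun q : FinJet n (N + 1) => ((1, 0) : FinJet n N) + shift N q) (shift N)
      (proj (N + 1) z) := (shift N).hasFDerivAt.const_add _
  have hcomp : fderiv ℝ (fun q => fderiv ℝ F (trunc N.le_succ q)) (proj (N + 1) z)
      = (fderiv ℝ (fderiv ℝ F) (proj N z)).comp (trunc N.le_succ) :=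
    (hd.hasFDerivAt.comp (proj (N + 1) z) (trunc N.le_succ).hasFDerivAt).fderiv
  have htr : trunc N.le_succ (dir (N + 1) k i) = dir N k i := rfl
  rw [fderiv_clm_apply hd' hsh.differentiableAt, fderiv_clm_apply hd (by fun_prop), hcomp,
    hsh.fderiv, trunc_proj]
  simp only [fderiv_fun_const, Pi.zero_apply, ContinuousLinearMap.comp_zero, zero_add,
    add_apply, ContinuousLinearMap.comp_apply,
    ContinuousLinearMap.flip_apply, htr]
  rw [hs.eq]
  ring

end HasRep

theorem shift_dir_zero (N : ℕ) (i : Fin n) : shift N (dir (N + 1) 0 i) = 0 :=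
  Prod.ext rfl (funext fun m => by simp [shift, dir])

theorem shift_dir_succ (N k : ℕ) (i : Fin n) : shift N (dir (N + 1) (k + 1) i) = dir N k i :=
  Prod.ext rfl (funext fun m => by simp [shift, dir])

end

/-! ### The algebra of differential functions over `U` as a jet algebra. -/

section

variable {n : ℕ}

/-- The infinite jet space over `U`. -/
abbrev JetOver (U : Set (Fin n → ℝ)) : Type := {z : Jet n // z.2 0 ∈ U}

open Classical in
/-- Extension by zero of a function on the jet space over `U`. -/
def extend {U : Set (Fin n → ℝ)} (a : JetOver U → ℝ) : Jet n → ℝ := fun z =>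
  if h : z.2 0 ∈ U then a ⟨z, h⟩ else 0

theorem extend_apply {U : Set (Fin n → ℝ)} (a : JetOver U → ℝ) (z : JetOver U) :
    extend a z = a z := by
  simp [extend, z.2]

theorem HasRep.add {U : Set (Fin n → ℝ)} {f g : Jet n → ℝ} {N : ℕ} {F G : FinJet n N → ℝ}
    (hf : HasRep U f N F) (hg : HasRep U g N G) :
    HasRep U (fun z => f z + g z) N (fun q => F q + G q) :=
  ⟨hf.smooth.add hg.smooth, fun z hz => by rw [hf.eq z hz, hg.eq z hz]⟩

theorem HasRep.mul {U : Set (Fin n → ℝ)} {f g : Jet n → ℝ} {N : ℕ} {F G : FinJet n N → ℝ}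
    (hf : HasRep U f N F) (hg : HasRep U g N G) :
    HasRep U (fun z => f z * g z) N (fun q => F q * G q) :=
  ⟨hf.smooth.mul hg.smooth, fun z hz => by rw [hf.eq z hz, hg.eq z hz]⟩

theorem hasRep_const (U : Set (Fin n → ℝ)) (r : ℝ) (N : ℕ) :
    HasRep U (fun _ => r) N (fun _ => r) :=
  ⟨contDiffOn_const, fun _ _ => rfl⟩

theorem IsDiffFun.exists_hasRep₂ {U : Set (Fin n → ℝ)} {f g : Jet n → ℝ} (hf : IsDiffFun U f)
    (hg : IsDiffFun U g) : ∃ N F G, HasRep U f N F ∧ HasRep U g N G := by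
  obtain ⟨N, F, hF⟩ := isDiffFun_iff.1 hf
  obtain ⟨M, G, hG⟩ := isDiffFun_iff.1 hg
  exact ⟨max N M, _, _, hF.raise (le_max_left N M), hG.raise (le_max_right N M)⟩

theorem IsDiffFun.congr {U : Set (Fin n → ℝ)} {f g : Jet n → ℝ} (hf : IsDiffFun U f)
    (h : ∀ z : Jet n, z.2 0 ∈ U → g z = f z) : IsDiffFun U g := by
  obtain ⟨N, F, hF⟩ := isDiffFun_iff.1 hf
  exact (hF.congr h).isDiffFun

theorem IsDiffFun.extend_restrict {U : Set (Fin n → ℝ)} {f : Jet n → ℝ} (hf : IsDiffFun U f) :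
    IsDiffFun U (extend fun z : JetOver U => f z) :=
  hf.congr fun z hz => extend_apply _ ⟨z, hz⟩

/-- The algebra of differential functions over `U`. -/
def diffSubalgebra (U : Set (Fin n → ℝ)) : Subalgebra ℝ (JetOver U → ℝ) where
  carrier := {a | IsDiffFun U (extend a)}
  mul_mem' := fun {a b} ha hb => by
    obtain ⟨N, F, G, hF, hG⟩ := ha.exists_hasRep₂ hb
    refine (hF.mul hG).isDiffFun.congr fun z hz => ?_
    rw [extend_apply _ ⟨z, hz⟩, extend_apply a ⟨z, hz⟩, extend_apply b ⟨z, hz⟩, Pi.mul_apply]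
  add_mem' := fun {a b} ha hb => by
    obtain ⟨N, F, G, hF, hG⟩ := ha.exists_hasRep₂ hb
    refine (hF.add hG).isDiffFun.congr fun z hz => ?_
    rw [extend_apply _ ⟨z, hz⟩, extend_apply a ⟨z, hz⟩, extend_apply b ⟨z, hz⟩, Pi.add_apply]
  algebraMap_mem' r := (hasRep_const U r 0).isDiffFun.congr fun z hz => extend_apply _ ⟨z, hz⟩

/-- The type of differential functions over `U`. -/
abbrev DiffAlg (U : Set (Fin n → ℝ)) : Type := diffSubalgebra U

namespace DiffAlg

variable {U : Set (Fin n → ℝ)}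

/-- The element of the algebra defined by a differential function. -/
def of (f : Jet n → ℝ) (hf : IsDiffFun U f) : DiffAlg U := ⟨fun z => f z, hf.extend_restrict⟩

/-- A differential function representing an element of the algebra. -/
def toFun (a : DiffAlg U) : Jet n → ℝ := extend a.1

theorem isDiffFun (a : DiffAlg U) : IsDiffFun U a.toFun := a.2

theorem toFun_apply (a : DiffAlg U) {z : Jet n} (hz : z.2 0 ∈ U) :
    a.toFun z = a.1 ⟨z, hz⟩ := extend_apply a.1 ⟨z, hz⟩

theorem toFun_of {f : Jet n → ℝ} (hf : IsDiffFun U f) {z : Jet n} (hz : z.2 0 ∈ U) :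
    (of f hf).toFun z = f z := toFun_apply _ hz

theorem ext_toFun {a b : DiffAlg U} (h : ∀ z : Jet n, z.2 0 ∈ U → a.toFun z = b.toFun z) :
    a = b :=
  Subtype.ext (funext fun z => by
    rw [← extend_apply a.1 z, ← extend_apply b.1 z]; exact h z z.2)

theorem toFun_add (a b : DiffAlg U) {z : Jet n} (hz : z.2 0 ∈ U) :
    (a + b).toFun z = a.toFun z + b.toFun z := by
  rw [toFun_apply _ hz, toFun_apply _ hz, toFun_apply _ hz]; rfl

theorem toFun_mul (a b : DiffAlg U) {z : Jet n} (hz : z.2 0 ∈ U) :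
    (a * b).toFun z = a.toFun z * b.toFun z := by
  rw [toFun_apply _ hz, toFun_apply _ hz, toFun_apply _ hz]; rfl

theorem toFun_smul (r : ℝ) (a : DiffAlg U) {z : Jet n} (hz : z.2 0 ∈ U) :
    (r • a).toFun z = r * a.toFun z := by
  rw [toFun_apply _ hz, toFun_apply _ hz]; rfl

/-- Evaluation at a jet over `U`. -/
def eval (z : JetOver U) : DiffAlg U →ₐ[ℝ] ℝ :=
  (Pi.evalAlgHom ℝ (fun _ : JetOver U => ℝ) z).comp (diffSubalgebra U).val

theorem eval_eq (z : JetOver U) (a : DiffAlg U) : eval z a = a.toFun z :=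
  (extend_apply a.1 z).symm

theorem ext_eval {a b : DiffAlg U} (h : ∀ z, eval z a = eval z b) : a = b :=
  Subtype.ext (funext h)

theorem exists_hasRep (a : DiffAlg U) : ∃ N F, HasRep U a.toFun N F :=
  isDiffFun_iff.1 a.isDiffFun

theorem exists_hasRep₂ (a b : DiffAlg U) :
    ∃ N F G, HasRep U a.toFun N F ∧ HasRep U b.toFun N G :=
  a.isDiffFun.exists_hasRep₂ b.isDiffFun

/-- A derivation from an operation on functions given by directional derivatives of
representatives. -/
def mkDerivation (hU : IsOpen U) (Φ : (Jet n → ℝ) → Jet n → ℝ)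
    (hΦ : ∀ f, IsDiffFun U f → IsDiffFun U (Φ f)) (v : ∀ N, Jet n → FinJet n N)
    (hv : ∀ f N F, HasRep U f N F → ∀ z : Jet n, z.2 0 ∈ U →
      Φ f z = fderiv ℝ F (proj N z) (v N z)) : Derivation ℝ (DiffAlg U) (DiffAlg U) :=
  Derivation.mk'
    { toFun := fun a => of (Φ a.toFun) (hΦ _ a.isDiffFun)
      map_add' := fun a b => ext_toFun fun z hz => by
        obtain ⟨N, F, G, hF, hG⟩ := exists_hasRep₂ a b
        have hab : HasRep U (a + b).toFun N _ := (hF.add hG).congr fun z hz => toFun_add a b hz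
        rw [toFun_add _ _ hz, toFun_of _ hz, toFun_of _ hz, toFun_of _ hz, hv _ _ _ hab z hz,
          hv _ _ _ hF z hz, hv _ _ _ hG z hz,
          fderiv_fun_add (hF.differentiableAt hU hz) (hG.differentiableAt hU hz)]
        rfl
      map_smul' := fun r a => ext_toFun fun z hz => by
        obtain ⟨N, F, hF⟩ := exists_hasRep a
        have hra : HasRep U (r • a).toFun N _ :=
          ((hasRep_const U r N).mul hF).congr fun z hz => toFun_smul r a hz
        rw [RingHom.id_apply, toFun_smul _ _ hz, toFun_of _ hz, toFun_of _ hz, hv _ _ _ hra z hz,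
          hv _ _ _ hF z hz, fderiv_const_mul (hF.differentiableAt hU hz)]
        rfl }
    (fun a b => ext_toFun fun z hz => by
      obtain ⟨N, F, G, hF, hG⟩ := exists_hasRep₂ a b
      have hab : HasRep U (a * b).toFun N _ := (hF.mul hG).congr fun z hz => toFun_mul a b hz
      simp only [LinearMap.coe_mk, AddHom.coe_mk, smul_eq_mul]
      rw [toFun_add _ _ hz, toFun_mul _ _ hz, toFun_mul _ _ hz, toFun_of _ hz, toFun_of _ hz,
        toFun_of _ hz, hv _ _ _ hab z hz, hv _ _ _ hF z hz, hv _ _ _ hG z hz,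
        fderiv_fun_mul (hF.differentiableAt hU hz) (hG.differentiableAt hU hz), hF.eq z hz,
        hG.eq z hz]
      rfl)

theorem isDiffFun_jetDeriv (hU : IsOpen U) (k : ℕ) (i : Fin n) {f : Jet n → ℝ}
    (hf : IsDiffFun U f) : IsDiffFun U (jetDeriv k i f) := by
  obtain ⟨N, F, hF⟩ := isDiffFun_iff.1 hf
  exact (hF.jetDeriv hU k i).isDiffFun

theorem isDiffFun_totalDeriv (hU : IsOpen U) {f : Jet n → ℝ}
    (hf : IsDiffFun U f) : IsDiffFun U (totalDeriv f) := by
  obtain ⟨N, F, hF⟩ := isDiffFun_iff.1 hf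
  exact (hF.totalDeriv hU).isDiffFun

/-- Elements of the algebra are represented by extension by zero, so the derivatives must not depend
on values off `U`. -/
theorem jetDeriv_congr (hU : IsOpen U) {f g : Jet n → ℝ} (hf : IsDiffFun U f)
    (h : ∀ z : Jet n, z.2 0 ∈ U → g z = f z) (k : ℕ) (i : Fin n) {z : Jet n} (hz : z.2 0 ∈ U) :
    jetDeriv k i g z = jetDeriv k i f z := by
  obtain ⟨N, F, hF⟩ := isDiffFun_iff.1 hf
  rw [hF.jetDeriv_eq hU k i hz, (hF.congr h).jetDeriv_eq hU k i hz]

theorem totalDeriv_congr (hU : IsOpen U) {f g : Jet n → ℝ} (hf : IsDiffFun U f)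
    (h : ∀ z : Jet n, z.2 0 ∈ U → g z = f z) {z : Jet n} (hz : z.2 0 ∈ U) :
    totalDeriv g z = totalDeriv f z := by
  obtain ⟨N, F, hF⟩ := isDiffFun_iff.1 hf
  rw [hF.totalDeriv_eq hU hz, (hF.congr h).totalDeriv_eq hU hz]

theorem hasRep_coord (U : Set (Fin n → ℝ)) (k : ℕ) (i : Fin n) :
    HasRep U (fun z => z.2 k i) k (fun q => q.2 (Fin.last k) i) where
  smooth := by fun_prop
  eq z _ := by simp [proj]

theorem hasRep_x (U : Set (Fin n → ℝ)) : HasRep U (fun z => z.1) 0 (fun q => q.1) where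
  smooth := by fun_prop
  eq z _ := rfl

theorem hasRep_point {φ : (Fin n → ℝ) → ℝ} (hφ : ContDiffOn ℝ ∞ φ U) :
    HasRep U (fun z => φ (z.2 0)) 0 (fun q => φ (q.2 0)) where
  smooth := hφ.comp (t := U) (by fun_prop) fun _ hq => hq
  eq z _ := rfl

theorem _root_.HydroPair.HasRep.toFun_of {f : Jet n → ℝ} {N : ℕ} {F : FinJet n N → ℝ}
    (h : HasRep U f N F) : HasRep U (of f h.isDiffFun).toFun N F :=
  h.congr fun _ hz => DiffAlg.toFun_of h.isDiffFun hz

/-- The total derivative on the algebra of differential functions. -/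
def totalD (hU : IsOpen U) : Derivation ℝ (DiffAlg U) (DiffAlg U) :=
  mkDerivation hU totalDeriv (fun _ => isDiffFun_totalDeriv hU)
    (fun N z => (1, 0) + shift N (proj (N + 1) z))
    (fun _ _ _ hF _ hz => hF.totalDeriv_eq hU hz)

/-- The partial derivatives on the algebra of differential functions. -/
def jetD (hU : IsOpen U) (k : ℕ) (i : Fin n) : Derivation ℝ (DiffAlg U) (DiffAlg U) :=
  mkDerivation hU (jetDeriv k i) (fun _ => isDiffFun_jetDeriv hU k i) (fun N _ => dir N k i)
    (fun _ _ _ hF _ hz => hF.jetDeriv_eq hU k i hz)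

theorem toFun_totalD (hU : IsOpen U) (a : DiffAlg U) {z : Jet n} (hz : z.2 0 ∈ U) :
    (totalD hU a).toFun z = totalDeriv a.toFun z :=
  toFun_of (isDiffFun_totalDeriv hU a.isDiffFun) hz

theorem toFun_jetD (hU : IsOpen U) (k : ℕ) (i : Fin n) (a : DiffAlg U) {z : Jet n}
    (hz : z.2 0 ∈ U) : (jetD hU k i a).toFun z = jetDeriv k i a.toFun z :=
  toFun_of (isDiffFun_jetDeriv hU k i a.isDiffFun) hz

/-- The coordinate `u^i_{(k)}`. -/
def coord (U : Set (Fin n → ℝ)) (k : ℕ) (i : Fin n) : DiffAlg U :=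
  of _ (hasRep_coord U k i).isDiffFun

/-- The independent variable. -/
def xvar (U : Set (Fin n → ℝ)) : DiffAlg U := of _ (hasRep_x U).isDiffFun

/-- A function of the field variables. -/
def point (φ : (Fin n → ℝ) → ℝ) (hφ : ContDiffOn ℝ ∞ φ U) : DiffAlg U :=
  of _ (hasRep_point hφ).isDiffFun

theorem hasRep_coord_toFun (U : Set (Fin n → ℝ)) (k : ℕ) (i : Fin n) :
    HasRep U (coord U k i).toFun k (fun q => q.2 (Fin.last k) i) := (hasRep_coord U k i).toFun_of

theorem hasRep_xvar (U : Set (Fin n → ℝ)) : HasRep U (xvar U).toFun 0 (fun q => q.1) :=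
  (hasRep_x U).toFun_of

theorem hasRep_point_toFun {φ : (Fin n → ℝ) → ℝ} (hφ : ContDiffOn ℝ ∞ φ U) :
    HasRep U (point φ hφ).toFun 0 (fun q => φ (q.2 0)) := (hasRep_point hφ).toFun_of

theorem jetD_comm (hU : IsOpen U) (k l : ℕ) (i j : Fin n) (a : DiffAlg U) :
    jetD hU k i (jetD hU l j a) = jetD hU l j (jetD hU k i a) := by
  refine ext_toFun fun z hz => ?_
  obtain ⟨N, F, hF⟩ := exists_hasRep a
  rw [toFun_jetD hU _ _ _ hz, toFun_jetD hU _ _ _ hz,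
    jetDeriv_congr hU (isDiffFun_jetDeriv hU l j a.isDiffFun)
      (fun z hz => toFun_jetD hU l j a hz) k i hz,
    jetDeriv_congr hU (isDiffFun_jetDeriv hU k i a.isDiffFun)
      (fun z hz => toFun_jetD hU k i a hz) l j hz]
  exact hF.jetDeriv_comm hU k l i j hz

theorem jetDeriv_totalD (hU : IsOpen U) {a : DiffAlg U} {N : ℕ} {F : FinJet n N → ℝ}
    (hF : HasRep U a.toFun N F) (k : ℕ) (i : Fin n) {z : Jet n} (hz : z.2 0 ∈ U) :
    (jetD hU k i (totalD hU a)).toFun z = (totalD hU (jetD hU k i a)).toFun z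
      + fderiv ℝ F (proj N z) (shift N (dir (N + 1) k i)) := by
  rw [toFun_jetD hU _ _ _ hz, toFun_totalD hU _ hz,
    jetDeriv_congr hU (isDiffFun_totalDeriv hU a.isDiffFun)
      (fun z hz => toFun_totalD hU a hz) k i hz,
    totalDeriv_congr hU (isDiffFun_jetDeriv hU k i a.isDiffFun)
      (fun z hz => toFun_jetD hU k i a hz) hz]
  exact hF.jetDeriv_totalDeriv hU k i hz

theorem fderiv_topCoord (k : ℕ) (i : Fin n) (q v : FinJet n k) :
    fderiv ℝ (fun q : FinJet n k => q.2 (Fin.last k) i) q v = v.2 (Fin.last k) i := by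
  let L : FinJet n k →L[ℝ] ℝ := (ContinuousLinearMap.proj i).comp
    ((ContinuousLinearMap.proj (Fin.last k)).comp
      (ContinuousLinearMap.snd ℝ ℝ (Fin (k + 1) → Fin n → ℝ)))
  have h : HasFDerivAt (fun q : FinJet n k => q.2 (Fin.last k) i) L q := L.hasFDerivAt
  rw [h.fderiv]
  rfl

theorem fderiv_fst_apply (k : ℕ) (q v : FinJet n k) :
    fderiv ℝ (fun q : FinJet n k => q.1) q v = v.1 := by
  have h : HasFDerivAt (fun q : FinJet n k => q.1)
    (ContinuousLinearMap.fst ℝ ℝ (Fin (k + 1) → Fin n → ℝ)) q := hasFDerivAt_fst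
  rw [h.fderiv]
  rfl

theorem jetD_coord (hU : IsOpen U) (k l : ℕ) (i j : Fin n) :
    jetD hU k i (coord U l j) = if k = l ∧ i = j then 1 else 0 := by
  refine ext_toFun fun z hz => ?_
  rw [toFun_jetD hU _ _ _ hz, (hasRep_coord_toFun U l j).jetDeriv_eq hU k i hz]
  rw [fderiv_topCoord, toFun_apply _ hz]
  by_cases hk : k = l
  · by_cases hi : i = j
    · simp [dir, hk, hi]
    · simp [dir, hk, hi, Ne.symm hi]
  · simp [dir, hk, Ne.symm hk]

theorem totalD_coord (hU : IsOpen U) (k : ℕ) (i : Fin n) :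
    totalD hU (coord U k i) = coord U (k + 1) i := by
  refine ext_toFun fun z hz => ?_
  rw [toFun_totalD hU _ hz, (hasRep_coord_toFun U k i).totalDeriv_eq hU hz]
  rw [fderiv_topCoord, coord, toFun_of _ hz]
  simp [shift, proj]

theorem jetD_x (hU : IsOpen U) (k : ℕ) (i : Fin n) : jetD hU k i (xvar U) = 0 := by
  refine ext_toFun fun z hz => ?_
  rw [toFun_jetD hU _ _ _ hz, (hasRep_xvar U).jetDeriv_eq hU k i hz]
  rw [fderiv_fst_apply, toFun_apply _ hz]
  simp [dir]

theorem totalD_x (hU : IsOpen U) : totalD hU (xvar U) = 1 := by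
  refine ext_toFun fun z hz => ?_
  rw [toFun_totalD hU _ hz, (hasRep_xvar U).totalDeriv_eq hU hz]
  rw [fderiv_fst_apply, toFun_apply _ hz]
  simp [shift]

theorem fderiv_point (hU : IsOpen U) {φ : (Fin n → ℝ) → ℝ} (hφ : ContDiffOn ℝ ∞ φ U) {z : Jet n}
    (hz : z.2 0 ∈ U) (v : FinJet n 0) :
    fderiv ℝ (fun q : FinJet n 0 => φ (q.2 0)) (proj 0 z) v = fderiv ℝ φ (z.2 0) (v.2 0) := by
  have h1 : HasFDerivAt φ (fderiv ℝ φ (z.2 0)) (z.2 0) :=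
    ((hφ.contDiffAt (hU.mem_nhds hz)).differentiableAt (by simp)).hasFDerivAt
  let L : FinJet n 0 →L[ℝ] (Fin n → ℝ) :=
    (ContinuousLinearMap.proj 0).comp (ContinuousLinearMap.snd ℝ ℝ (Fin (0 + 1) → Fin n → ℝ))
  have h2 : HasFDerivAt (fun q : FinJet n 0 => q.2 0) L (proj 0 z) := L.hasFDerivAt
  have h3 : HasFDerivAt (fun q : FinJet n 0 => φ (q.2 0)) _ (proj 0 z) :=
    HasFDerivAt.comp (proj 0 z) (g := φ) h1 h2
  rw [h3.fderiv]
  rfl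

theorem _root_.ContDiffOn.pd (hU : IsOpen U) {φ : (Fin n → ℝ) → ℝ} (hφ : ContDiffOn ℝ ∞ φ U)
    (s : Fin n) : ContDiffOn ℝ ∞ (pd s φ) U :=
  (hφ.fderiv_of_isOpen hU (by simp)).clm_apply contDiffOn_const

theorem jetD_zero_point (hU : IsOpen U) {φ : (Fin n → ℝ) → ℝ} (hφ : ContDiffOn ℝ ∞ φ U)
    (i : Fin n) : jetD hU 0 i (point φ hφ) = point (pd i φ) (hφ.pd hU i) := by
  refine ext_toFun fun z hz => ?_
  rw [toFun_jetD hU _ _ _ hz, (hasRep_point_toFun hφ).jetDeriv_eq hU 0 i hz, fderiv_point hU hφ hz, point,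
    toFun_of _ hz]
  simp [dir, pd]

theorem jetD_succ_point (hU : IsOpen U) {φ : (Fin n → ℝ) → ℝ} (hφ : ContDiffOn ℝ ∞ φ U)
    (k : ℕ) (i : Fin n) : jetD hU (k + 1) i (point φ hφ) = 0 := by
  refine ext_toFun fun z hz => ?_
  rw [toFun_jetD hU _ _ _ hz, (hasRep_point_toFun hφ).jetDeriv_eq hU (k + 1) i hz, toFun_apply _ hz,
    dir_eq_zero (by omega), map_zero]
  rfl

theorem totalD_point (hU : IsOpen U) {φ : (Fin n → ℝ) → ℝ} (hφ : ContDiffOn ℝ ∞ φ U) :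
    totalD hU (point φ hφ) = ∑ s, coord U 1 s * point (pd s φ) (hφ.pd hU s) := by
  refine ext_eval fun z => ?_
  rw [eval_eq, toFun_totalD hU _ z.2, (hasRep_point_toFun hφ).totalDeriv_eq hU z.2, fderiv_point hU hφ z.2]
  have h : ((((1, 0) : FinJet n 0) + shift 0 (proj (0 + 1) z.1)).2 0)
      = ∑ s, z.1.2 1 s • (Pi.single s 1 : Fin n → ℝ) := by
    rw [← pi_eq_sum_univ' (z.1.2 1)]
    simp [shift, proj]
  rw [h]
  simp only [map_sum, map_mul, map_smul, smul_eq_mul, eval_eq, coord, point, toFun_of _ z.2, pd]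

/-- The algebra of differential functions is a differential algebra with jet coordinates. -/
def jetAlgebra (hU : IsOpen U) : JetAlgebra (Fin n) (DiffAlg U) where
  D := totalD hU
  p := jetD hU
  u := coord U 0
  p_comm k i l j a := jetD_comm hU k l i j a
  p_zero_D i a := ext_toFun fun z hz => by
    obtain ⟨N, F, hF⟩ := exists_hasRep a
    rw [jetDeriv_totalD hU hF 0 i hz, shift_dir_zero, map_zero, add_zero]
  p_succ_D k i a := ext_toFun fun z hz => by
    obtain ⟨N, F, hF⟩ := exists_hasRep a
    rw [jetDeriv_totalD hU hF (k + 1) i hz, shift_dir_succ, toFun_add _ _ hz,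
      toFun_jetD hU k i a hz, hF.jetDeriv_eq hU k i hz]
  exists_order a := by
    obtain ⟨N, F, hF⟩ := exists_hasRep a
    refine ⟨N + 1, fun k hk i => ext_toFun fun z hz => ?_⟩
    rw [toFun_jetD hU k i a hz, hF.jetDeriv_eq hU k i hz, dir_eq_zero hk, map_zero,
      toFun_apply _ hz]
    rfl
  p_zero_u i j := by simp [jetD_coord]
  p_succ_u k i j := by simp [jetD_coord]

end DiffAlg

end

/-! ### Test densities and necessity of the coefficient identities. -/

section

namespace JetAlgebra

variable {ι A : Type*} [Fintype ι] [DecidableEq ι] [CommRing A] [Algebra ℝ A]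
  (𝒥 : JetAlgebra ι A)

/-- `r` does not depend on the jet variables. -/
def IsFree (r : A) : Prop := ∀ k i, 𝒥.p k i r = 0

/-- The variational derivative of some density is `r` in the direction `l` and zero in the
other directions. -/
def IsTest (l : ι) (r : A) : Prop := ∃ b, ∀ j, 𝒥.euler j b = (Pi.single l r : ι → A) j

variable {𝒥}

omit [Fintype ι] in
theorem IsFree.isTest {r : A} (hr : 𝒥.IsFree r) (l : ι) : 𝒥.IsTest l r := by
  refine ⟨r * 𝒥.u l, fun j => ?_⟩
  have h : 𝒥.OrderLE (r * 𝒥.u l) 1 := by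
    intro k hk i
    obtain ⟨m, rfl⟩ := Nat.exists_eq_add_of_le' hk
    simp [hr _ _, 𝒥.p_succ_u m i l]
  rw [𝒥.euler_eq j h]
  by_cases hj : j = l
  · subst hj; simp [hr 0 j, 𝒥.p_zero_u]
  · simp [hr 0 j, 𝒥.p_zero_u, hj]

omit [Fintype ι] in
theorem IsFree.isTest_mul_u {r : A} (hr : 𝒥.IsFree r) (l : ι) : 𝒥.IsTest l (r * 𝒥.u l) := by
  refine ⟨(1 / 2 : ℝ) • (r * (𝒥.u l * 𝒥.u l)), fun j => ?_⟩
  have h : 𝒥.OrderLE ((1 / 2 : ℝ) • (r * (𝒥.u l * 𝒥.u l))) 1 := by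
    intro k hk i
    obtain ⟨m, rfl⟩ := Nat.exists_eq_add_of_le' hk
    simp [hr _ _, 𝒥.p_succ_u m i l]
  rw [𝒥.euler_eq j h]
  by_cases hj : j = l
  · subst hj
    simp only [Finset.range_one, Finset.sum_singleton, pow_zero, one_smul, Module.End.one_apply,
      Derivation.map_smul, Derivation.leibniz, hr 0 j, 𝒥.p_zero_u, if_true, smul_eq_mul, Pi.single_eq_same]
    have : r * (𝒥.u j * 1 + 𝒥.u j * 1) + 𝒥.u j * 𝒥.u j * 0 = (2 : ℝ) • (r * 𝒥.u j) := by
      rw [two_smul]; ring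
    rw [this, smul_smul]
    norm_num
  · simp [hr 0 j, 𝒥.p_zero_u, hj]

omit [Fintype ι] in
theorem IsFree.pow {r : A} (hr : 𝒥.IsFree r) (m : ℕ) : 𝒥.IsFree (r ^ m) := fun k i => by
  simp [hr k i]

omit [Fintype ι] in
theorem isFree_one : 𝒥.IsFree (1 : A) := fun k i => by simp

namespace Coeffs

variable (C : 𝒥.Coeffs)

theorem bracket_of_single {a b : A} {i j : ι} {p r : A}
    (ha : ∀ s, 𝒥.euler s a = (Pi.single i p : ι → A) s)
    (hb : ∀ s, 𝒥.euler s b = (Pi.single j r : ι → A) s) :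
    C.bracket a b = p * (C.g i j * 𝒥.D r + C.β i j * r) := by
  rw [bracket, opBracket, Finset.sum_eq_single i _ (by simp), ha, Pi.single_eq_same, opApply,
    Finset.sum_eq_single j _ (by simp), hb, Pi.single_eq_same]
  · intro s _ hs
    simp [hb, hs]
  · intro s _ hs
    simp [ha, hs]

/-- Against a density with variational derivative `1` in direction `i`, the first-order parts of the
two brackets add up to `D (g^{ij} r)`, leaving only the symmetrized `w`. -/
theorem IsHam.mul_w_mem_null {C : 𝒥.Coeffs} (h : C.IsHam) {i j : ι} {r : A}
    (hr : 𝒥.IsTest j r) : r * (C.w i j + C.w j i) ∈ 𝒥.null := by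
  obtain ⟨b, hb⟩ := hr
  obtain ⟨a, ha⟩ := (isFree_one (𝒥 := 𝒥)).isTest i
  have h1 := h.skew a b
  rw [C.bracket_of_single ha hb, C.bracket_of_single hb ha] at h1
  have h2 := 𝒥.D_mem_null (C.g i j * r)
  have h3 := Submodule.sub_mem _ h1 h2
  convert h3 using 1
  have hD : 𝒥.D (C.g i j) = ∑ k, C.b i j k * 𝒥.D (𝒥.u k) + ∑ k, C.b j i k * 𝒥.D (𝒥.u k) := by
    rw [(C.g_point i j).D_eq, ← Finset.sum_add_distrib]
    exact Finset.sum_congr rfl fun k _ => by rw [C.g_deriv]; ring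
  simp only [Derivation.leibniz, smul_eq_mul, hD, β, Derivation.map_one_eq_zero]
  ring

theorem cell_zero_left (i j l : ι) (y z : A) : C.cell i j l 0 y z = 0 := by simp [cell]

theorem cell_zero_mid (i j l : ι) (x z : A) : C.cell i j l x 0 z = 0 := by simp [cell]

theorem cell_zero_right (i j l : ι) (x y : A) : C.cell i j l x y 0 = 0 := by simp [cell]

theorem cyc_mem_null_of_isTest {C : 𝒥.Coeffs} (h : C.IsHam)
    (hw : ∀ i j, C.w i j + C.w j i = 0) {i j l : ι} {p q r : A}
    (hp : 𝒥.IsTest i p) (hq : 𝒥.IsTest j q) (hr : 𝒥.IsTest l r) :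
    C.cyc i j l p q r ∈ 𝒥.null := by
  obtain ⟨a, ha⟩ := hp
  obtain ⟨b, hb⟩ := hq
  obtain ⟨c, hc⟩ := hr
  have h1 := (Submodule.sub_mem_iff_right _ (h.jacobi a b c)).1
    (C.jacobi_sub_sum_cyc_mem_null hw a b c)
  rw [Finset.sum_eq_single i, Finset.sum_eq_single j, Finset.sum_eq_single l] at h1
  · simpa [ha, hb, hc] using h1
  · intro s _ hs
    simp [hc, hs, cyc, cell_zero_left, cell_zero_mid, cell_zero_right]
  · simp
  · intro s _ hs
    simp [hb, hs, cyc, cell_zero_left, cell_zero_mid, cell_zero_right]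
  · simp
  · intro s _ hs
    simp [ha, hs, cyc, cell_zero_left, cell_zero_mid, cell_zero_right]
  · simp

/-- The normal form `cyc` after moving all derivatives off the third argument. -/
def residue (i j l : ι) (p q : A) : A :=
  (C.gb j i l - C.gb i j l) * (𝒥.D p * 𝒥.D q) + C.K j l i * (p * 𝒥.D q)
    + C.K i j l * (𝒥.D p * q) + (C.βw l i j + C.βw i j l + C.βw j l i) * (p * q)
    - 𝒥.D ((C.gb l j i - C.gb j l i) * (p * 𝒥.D q) + (C.gb i l j - C.gb l i j) * (q * 𝒥.D p)
      + C.K l i j * (p * q))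

theorem mul_residue_mem_null {i j l : ι} {p q r : A} (h : C.cyc i j l p q r ∈ 𝒥.null) :
    r * C.residue i j l p q ∈ 𝒥.null := by
  have h1 := 𝒥.D_mem_null (r * ((C.gb l j i - C.gb j l i) * (p * 𝒥.D q)
    + (C.gb i l j - C.gb l i j) * (q * 𝒥.D p) + C.K l i j * (p * q)))
  have h2 := Submodule.sub_mem _ h h1
  convert h2 using 1
  rw [C.cyc_eq, residue, Derivation.leibniz]
  simp only [smul_eq_mul]
  ring

end Coeffs

-- Every derivative has to fall on the power of `y`, since all other terms keep an additional factor
-- `y`. The constant is `(k + j)! / j!`, of which only the nonvanishing matters.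
omit [Fintype ι] in
theorem exists_Dp_pow_mul {y : A} (hy : 𝒥.D y = 1) (a : A) (k j : ℕ) :
    ∃ (r : ℝ) (b : A), r ≠ 0 ∧ 𝒥.Dp k (y ^ (k + j) * a) = y ^ j * (r • a + y * b) := by
  induction k generalizing j with
  | zero => exact ⟨1, 0, one_ne_zero, by simp⟩
  | succ k ih =>
    obtain ⟨r, b, hr, h⟩ := ih (j + 1)
    refine ⟨(j + 1) * r, ((j : A) + 1) * b + 𝒥.D (r • a + y * b), by positivity, ?_⟩
    rw [𝒥.Dp_succ, show k + 1 + j = k + (j + 1) by ring, h, Derivation.leibniz,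
      Derivation.leibniz_pow, hy, mul_smul]
    rw [← Nat.cast_smul_eq_nsmul A]
    simp only [add_tsub_cancel_right, smul_eq_mul, Algebra.smul_def, map_add,
      map_natCast, map_one]
    push_cast
    ring

end JetAlgebra

namespace DiffAlg

variable {n : ℕ} {U : Set (Fin n → ℝ)}

/-- The function `x - c`. -/
def xsub (U : Set (Fin n → ℝ)) (c : ℝ) : DiffAlg U := xvar U - algebraMap ℝ (DiffAlg U) c

theorem eval_xsub (z : JetOver U) : eval z (xsub U z.1.1) = 0 := by
  rw [xsub, map_sub, AlgHom.commutes, eval_eq, xvar, toFun_of _ z.2]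
  simp

theorem D_xsub (hU : IsOpen U) (c : ℝ) : (jetAlgebra hU).D (xsub U c) = 1 := by
  rw [xsub, map_sub, Derivation.map_algebraMap, sub_zero]
  exact totalD_x hU

theorem isFree_xsub (hU : IsOpen U) (c : ℝ) : (jetAlgebra hU).IsFree (xsub U c) := fun k i => by
  rw [xsub, map_sub, Derivation.map_algebraMap, sub_zero]
  exact jetD_x hU k i

/-- The Euler operator annihilates `(x - c)^m Z`. If `m` is the top order of `Z`, then at `x = c`
the terms of order below `m` retain a factor `x - c`, while the last one is a nonzero multiple of
`∂Z/∂u^l_{(m)}`. Hence the order can be lowered repeatedly. -/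
theorem jetD_eq_zero_of_mul_mem_null (hU : IsOpen U) {Z : DiffAlg U}
    (h : ∀ c k, xsub U c ^ k * Z ∈ (jetAlgebra hU).null) (m : ℕ) (l : Fin n) :
    (jetAlgebra hU).p m l Z = 0 := by
  set 𝒥 := jetAlgebra hU with h𝒥
  have key : ∀ m, 𝒥.OrderLE Z (m + 1) → ∀ l, 𝒥.p m l Z = 0 := by
    intro m hm l
    refine ext_eval fun z => ?_
    set y := xsub U z.1.1 with hy
    have hfree : 𝒥.IsFree (y ^ m) := (isFree_xsub hU _).pow m
    have hp : ∀ k i, 𝒥.p k i (y ^ m * Z) = y ^ m * 𝒥.p k i Z := fun k i => by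
      rw [Derivation.leibniz, hfree k i]; simp
    have ho : 𝒥.OrderLE (y ^ m * Z) (m + 1) := fun k hk i => by rw [hp, hm k hk i, mul_zero]
    have h0 := 𝒥.euler_eq_zero_of_mem_null l (h z.1.1 m)
    rw [𝒥.euler_eq l ho] at h0
    have h1 := congrArg (eval z) h0
    rw [map_sum, Finset.sum_range_succ, Finset.sum_eq_zero, zero_add, map_zero] at h1
    · obtain ⟨r, b, hr, hb⟩ := JetAlgebra.exists_Dp_pow_mul (D_xsub hU z.1.1) (𝒥.p m l Z) m 0
      rw [hp] at h1
      rw [add_zero] at hb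
      rw [hb, map_smul, pow_zero, one_mul, map_add, map_mul, map_smul, eval_xsub] at h1
      rw [map_zero]
      simpa [hr] using h1
    · intro k hk
      obtain ⟨j, rfl⟩ := Nat.exists_eq_add_of_lt (Finset.mem_range.1 hk)
      obtain ⟨r, b, hr, hb⟩ := JetAlgebra.exists_Dp_pow_mul (D_xsub hU z.1.1) (𝒥.p k l Z) k (j + 1)
      rw [hp, add_assoc, hb, map_smul, map_mul, map_pow, eval_xsub]
      simp
  -- `key` improves any bound on the order by one; this is iterated until the bound drops to `m`.
  have hall : ∀ d N, 𝒥.OrderLE Z N → N ≤ m + d → 𝒥.p m l Z = 0 := by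
    intro d
    induction d with
    | zero => intro N hN hm; exact hN m hm l
    | succ d ih =>
      intro N hN hm
      have hN' := hN.mono hm
      refine ih (m + d) (fun k hk i => ?_) le_rfl
      rcases hk.eq_or_lt with rfl | hk
      · exact key _ hN' i
      · exact hN' k hk i
  exact hall (𝒥.order Z) _ (𝒥.orderLE_order Z) (by omega)

/-- Powers of `x - c` cannot detect a `Z` depending on `x` alone, as every such function is a total
derivative. The tests `(x - c)^k u^l` can: once `∂Z/∂u^l = 0`, the derivative of `u^l Z` by `u^l` is
`Z` itself. -/
theorem eq_zero_of_isTest_mul_mem_null (hU : IsOpen U) {Z : DiffAlg U} (l : Fin n)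
    (h : ∀ r, (jetAlgebra hU).IsTest l r → r * Z ∈ (jetAlgebra hU).null) : Z = 0 := by
  have hf : ∀ c k, (jetAlgebra hU).IsFree (xsub U c ^ k) := fun c k => (isFree_xsub hU c).pow k
  have h1 := jetD_eq_zero_of_mul_mem_null hU (fun c k => h _ ((hf c k).isTest l)) 0 l
  have h2 := jetD_eq_zero_of_mul_mem_null hU (Z := (jetAlgebra hU).u l * Z) (fun c k => by
    rw [← mul_assoc]; exact h _ ((hf c k).isTest_mul_u l)) 0 l
  rw [Derivation.leibniz, h1, (jetAlgebra hU).p_zero_u] at h2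
  simpa using h2

/-- For necessity, the third argument of `cyc` is an arbitrary test, so every `residue` vanishes.
The choice `p = 1` with `q` equal to `(x - c)^2`, then `x - c`, both read off at `x = c`, and
finally `q = 1`, isolates the coefficients with two, one and no derivatives on `q`. -/
theorem isHam_iff (hU : IsOpen U) (C : (jetAlgebra hU).Coeffs) : C.IsHam ↔ C.Conditions := by
  refine ⟨fun h => ?_, fun h => h.isHam⟩
  have hw : ∀ i j, C.w i j + C.w j i = 0 := fun i j =>
    eq_zero_of_isTest_mul_mem_null hU j fun r hr => h.mul_w_mem_null hr
  have hres : ∀ i j l p q, (jetAlgebra hU).IsFree p → (jetAlgebra hU).IsFree q →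
      C.residue i j l p q = 0 := fun i j l p q hp hq =>
    eq_zero_of_isTest_mul_mem_null hU l fun r hr => C.mul_residue_mem_null
      (JetAlgebra.Coeffs.cyc_mem_null_of_isTest h hw (hp.isTest i) (hq.isTest j) hr)
  have hgb : ∀ l j i, C.gb l j i = C.gb j l i := by
    intro l j i
    refine ext_eval fun z => ?_
    have h1 := hres i j l 1 (xsub U z.1.1 ^ 2) JetAlgebra.isFree_one ((isFree_xsub hU _).pow 2)
    have h2 := congrArg (eval z) h1
    rw [JetAlgebra.Coeffs.residue] at h2
    simp only [Derivation.leibniz, Derivation.map_one_eq_zero, pow_two, D_xsub, smul_eq_mul,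
      map_add, map_sub, map_mul, map_zero, map_one, eval_xsub] at h2
    linarith
  have hK : ∀ j l i, C.K j l i = C.K l i j := by
    intro j l i
    refine ext_eval fun z => ?_
    have h1 := hres i j l 1 (xsub U z.1.1) JetAlgebra.isFree_one (isFree_xsub hU _)
    have h2 := congrArg (eval z) h1
    rw [JetAlgebra.Coeffs.residue, hgb l j i, hgb i l j, sub_self, sub_self] at h2
    simp only [Derivation.leibniz, Derivation.map_one_eq_zero, D_xsub, smul_eq_mul,
      map_add, map_sub, map_mul, map_zero, map_one, eval_xsub] at h2
    linarith
  refine ⟨hw, hgb, hK, fun i j l => ?_⟩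
  have h1 := hres i j l 1 1 JetAlgebra.isFree_one JetAlgebra.isFree_one
  rw [JetAlgebra.Coeffs.residue, hgb l j i, hgb i l j, sub_self, sub_self, ← hK l i j] at h1
  simp only [Derivation.map_one_eq_zero, mul_zero, mul_one, zero_add, add_zero] at h1
  rw [← hK l i j]
  exact (sub_eq_zero.1 h1).symm

end DiffAlg

end

/-! ### From the jet algebra to identities between functions on `U`. -/

section

variable {n : ℕ} {U : Set (Fin n → ℝ)}

/-- The function `f` on jets restricts to the element `a`. -/
def Agrees (f : Jet n → ℝ) (a : DiffAlg U) : Prop := ∀ z : JetOver U, f z = DiffAlg.eval z a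

namespace Agrees

variable {f g : Jet n → ℝ} {a b : DiffAlg U}

theorem apply_eq (h : Agrees f a) {z : Jet n} (hz : z.2 0 ∈ U) : f z = a.toFun z := by
  rw [h ⟨z, hz⟩, DiffAlg.eval_eq]

theorem of (hf : IsDiffFun U f) : Agrees f (DiffAlg.of f hf) := fun z => by
  rw [DiffAlg.eval_eq, DiffAlg.toFun_of hf z.2]

theorem toFun (a : DiffAlg U) : Agrees a.toFun a := fun z => (DiffAlg.eval_eq z a).symm

theorem totalDeriv (hU : IsOpen U) (h : Agrees f a) :
    Agrees (totalDeriv f) ((DiffAlg.jetAlgebra hU).D a) := fun z => by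
  rw [DiffAlg.totalDeriv_congr hU a.isDiffFun (fun _ hz => h.apply_eq hz) z.2, DiffAlg.eval_eq]
  exact (DiffAlg.toFun_totalD hU a z.2).symm

theorem jetDeriv (hU : IsOpen U) (h : Agrees f a) (k : ℕ) (i : Fin n) :
    Agrees (jetDeriv k i f) ((DiffAlg.jetAlgebra hU).p k i a) := fun z => by
  rw [DiffAlg.jetDeriv_congr hU a.isDiffFun (fun _ hz => h.apply_eq hz) k i z.2, DiffAlg.eval_eq]
  exact (DiffAlg.toFun_jetD hU k i a z.2).symm

theorem totalDeriv_iterate (hU : IsOpen U) (h : Agrees f a) (k : ℕ) :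
    Agrees (HydroPair.totalDeriv^[k] f) ((DiffAlg.jetAlgebra hU).Dp k a) := by
  induction k with
  | zero => simpa using h
  | succ k ih =>
    rw [Function.iterate_succ_apply', JetAlgebra.Dp_succ]
    exact ih.totalDeriv hU

theorem varDeriv (hU : IsOpen U) (h : Agrees f a) (i : Fin n) :
    Agrees (varDeriv f i) ((DiffAlg.jetAlgebra hU).euler i a) := fun z => by
  have hk : ∀ k, (HydroPair.totalDeriv^[k] (HydroPair.jetDeriv k i f)) z
      = DiffAlg.eval z ((DiffAlg.jetAlgebra hU).Dp k ((DiffAlg.jetAlgebra hU).p k i a)) :=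
    fun k => (h.jetDeriv hU k i).totalDeriv_iterate hU k z
  rw [HydroPair.varDeriv, finsum_eq_sum_of_support_subset
    (s := Finset.range ((DiffAlg.jetAlgebra hU).order a)), JetAlgebra.euler, map_sum]
  · exact Finset.sum_congr rfl fun k _ => by rw [hk, map_smul, smul_eq_mul]
  · intro k hk'
    by_contra hlt
    simp only [Finset.coe_range, Set.mem_Iio, not_lt] at hlt
    refine hk' ?_
    simp only [hk, (DiffAlg.jetAlgebra hU).orderLE_order a k hlt i, map_zero, mul_zero]

theorem add (hf : Agrees f a) (hg : Agrees g b) : Agrees (fun z => f z + g z) (a + b) :=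
  fun z => by simp only [hf z, hg z, map_add]

theorem isNullFunctional_iff (hU : IsOpen U) (h : Agrees f a) :
    IsNullFunctional U f ↔ a ∈ (DiffAlg.jetAlgebra hU).null := by
  constructor
  · rintro ⟨k, hk, hfk⟩
    refine ⟨DiffAlg.of k hk, DiffAlg.ext_eval fun z => ?_⟩
    rw [← h z, hfk z z.2]
    exact ((of hk).totalDeriv hU z).symm
  · rintro ⟨k, rfl⟩
    refine ⟨k.toFun, k.isDiffFun, fun z hz => ?_⟩
    rw [h ⟨z, hz⟩]
    exact ((toFun k).totalDeriv hU ⟨z, hz⟩).symm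

end Agrees

/-- Smoothness over `U` and the linear relations between `g` and `b` satisfied by the operators
`μ A + ν B`. -/
structure Op.IsRegular (U : Set (Fin n → ℝ)) (C : Op n) : Prop where
  g_smooth : ∀ i j, ContDiffOn ℝ ∞ (C.g i j) U
  b_smooth : ∀ i j k, ContDiffOn ℝ ∞ (C.b i j k) U
  w_smooth : ∀ i j, ContDiffOn ℝ ∞ (C.w i j) U
  g_symm : ∀ u ∈ U, ∀ i j, C.g i j u = C.g j i u
  g_deriv : ∀ u ∈ U, ∀ i j k, pd k (C.g i j) u = C.b i j k u + C.b j i k u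
  b_closed : ∀ u ∈ U, ∀ i j k s, pd s (C.b i j k) u = pd k (C.b i j s) u

namespace DiffAlg

theorem eval_point {φ : (Fin n → ℝ) → ℝ} (hφ : ContDiffOn ℝ ∞ φ U) (z : JetOver U) :
    eval z (point φ hφ) = φ (z.1.2 0) := by
  rw [eval_eq, point, toFun_of _ z.2]

theorem eval_coord (k : ℕ) (i : Fin n) (z : JetOver U) : eval z (coord U k i) = z.1.2 k i := by
  rw [eval_eq, coord, toFun_of _ z.2]

theorem eval_p_point (hU : IsOpen U) {φ : (Fin n → ℝ) → ℝ} (hφ : ContDiffOn ℝ ∞ φ U) (s : Fin n)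
    (z : JetOver U) : eval z ((jetAlgebra hU).p 0 s (point φ hφ)) = pd s φ (z.1.2 0) :=
  (congrArg (eval z) (jetD_zero_point hU hφ s)).trans (eval_point _ z)

theorem eval_D_u (hU : IsOpen U) (i : Fin n) (z : JetOver U) :
    eval z ((jetAlgebra hU).D ((jetAlgebra hU).u i)) = z.1.2 1 i :=
  (congrArg (eval z) (totalD_coord hU 0 i)).trans (eval_coord _ _ z)

theorem eval_D_D_u (hU : IsOpen U) (i : Fin n) (z : JetOver U) :
    eval z ((jetAlgebra hU).D ((jetAlgebra hU).D ((jetAlgebra hU).u i))) = z.1.2 2 i :=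
  (congrArg (eval z) ((congrArg (totalD hU) (totalD_coord hU 0 i)).trans
    (totalD_coord hU 1 i))).trans (eval_coord _ _ z)

theorem isPoint_point (hU : IsOpen U) {φ : (Fin n → ℝ) → ℝ} (hφ : ContDiffOn ℝ ∞ φ U) :
    (jetAlgebra hU).IsPoint (point φ hφ) where
  p_succ k s := jetD_succ_point hU hφ k s
  D_eq := by
    have h := totalD_point hU hφ
    refine h.trans (Finset.sum_congr rfl fun s _ => ?_)
    rw [← jetD_zero_point hU hφ s, ← totalD_coord hU 0 s]
    rfl

theorem eval_D_point (hU : IsOpen U) {φ : (Fin n → ℝ) → ℝ} (hφ : ContDiffOn ℝ ∞ φ U)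
    (z : JetOver U) :
    eval z ((jetAlgebra hU).D (point φ hφ)) = ∑ s, z.1.2 1 s * pd s φ (z.1.2 0) := by
  rw [(isPoint_point hU hφ).D_eq, map_sum]
  exact Finset.sum_congr rfl fun s _ => by rw [map_mul, eval_D_u, eval_p_point]

end DiffAlg

namespace Op

variable {C : Op n}

/-- The coefficients of a regular operator as elements of the algebra of differential
functions. -/
def IsRegular.coeffs (h : C.IsRegular U) (hU : IsOpen U) : (DiffAlg.jetAlgebra hU).Coeffs where
  g i j := DiffAlg.point _ (h.g_smooth i j)
  b i j k := DiffAlg.point _ (h.b_smooth i j k)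
  w i j := DiffAlg.point _ (h.w_smooth i j)
  g_point i j := DiffAlg.isPoint_point hU _
  b_point i j k := DiffAlg.isPoint_point hU _
  w_point i j := DiffAlg.isPoint_point hU _
  g_symm i j := DiffAlg.ext_eval fun z => by
    rw [DiffAlg.eval_point, DiffAlg.eval_point, h.g_symm _ z.2]
  g_deriv i j k := DiffAlg.ext_eval fun z => by
    rw [map_add, DiffAlg.eval_p_point, DiffAlg.eval_point, DiffAlg.eval_point, h.g_deriv _ z.2]
  b_closed i j k s := DiffAlg.ext_eval fun z => by
    rw [DiffAlg.eval_p_point, DiffAlg.eval_p_point, h.b_closed _ z.2]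

theorem IsRegular.agrees_bracket (h : C.IsRegular U) (hU : IsOpen U) {f g : Jet n → ℝ}
    {a b : DiffAlg U} (hf : Agrees f a) (hg : Agrees g b) :
    Agrees (C.bracket f g) ((h.coeffs hU).bracket a b) := fun z => by
  simp only [Op.bracket, Op.apply, JetAlgebra.Coeffs.bracket, JetAlgebra.opBracket,
    JetAlgebra.opApply, JetAlgebra.Coeffs.β, map_sum, map_mul, map_add]
  refine Finset.sum_congr rfl fun i _ => ?_
  rw [hf.varDeriv hU i z]
  congr 1
  refine Finset.sum_congr rfl fun j _ => ?_
  have e1 := (hg.varDeriv hU j).totalDeriv hU z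
  rw [e1, hg.varDeriv hU j z]
  simp only [IsRegular.coeffs, DiffAlg.eval_point, DiffAlg.eval_D_u]
  ring

theorem IsRegular.isHamiltonian_iff (h : C.IsRegular U) (hU : IsOpen U) :
    C.IsHamiltonian U ↔ (h.coeffs hU).IsHam := by
  have hbr := fun {f g : Jet n → ℝ} {a b : DiffAlg U} (hf : Agrees f a) (hg : Agrees g b) =>
    h.agrees_bracket hU hf hg
  constructor
  · rintro ⟨h1, h2⟩
    refine ⟨fun a b => ?_, fun a b c => ?_⟩
    · exact (((hbr (.toFun a) (.toFun b)).add (hbr (.toFun b)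
        (.toFun a))).isNullFunctional_iff hU).1 (h1 _ _ a.isDiffFun b.isDiffFun)
    · exact ((((hbr (hbr (.toFun a) (.toFun b)) (.toFun c)).add
        (hbr (hbr (.toFun b) (.toFun c)) (.toFun a))).add
        (hbr (hbr (.toFun c) (.toFun a)) (.toFun b))).isNullFunctional_iff hU).1
          (h2 _ _ _ a.isDiffFun b.isDiffFun c.isDiffFun)
  · rintro ⟨h1, h2⟩
    refine ⟨fun f g hf hg => ?_, fun f g k hf hg hk => ?_⟩
    · exact (((hbr (.of hf) (.of hg)).add (hbr (.of hg) (.of hf))).isNullFunctional_iff hU).2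
        (h1 _ _)
    · exact ((((hbr (hbr (.of hf) (.of hg)) (.of hk)).add
        (hbr (hbr (.of hg) (.of hk)) (.of hf))).add
        (hbr (hbr (.of hk) (.of hf)) (.of hg))).isNullFunctional_iff hU).2 (h2 _ _ _)

/-- `g^{sl} b^{ij}_s`. -/
def gb (C : Op n) (l i j : Fin n) (u : Fin n → ℝ) : ℝ := ∑ s, C.g s l u * C.b i j s u

/-- `b^{sl}_k b^{ij}_s`. -/
def bb (C : Op n) (l i j k : Fin n) (u : Fin n → ℝ) : ℝ := ∑ s, C.b s l k u * C.b i j s u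

/-- `g^{js} ∂_s w^{li} + w^{sl} b^{ji}_s - w^{si} b^{jl}_s`. -/
def phi (C : Op n) (j l i : Fin n) (u : Fin n → ℝ) : ℝ :=
  ∑ s, (C.g s j u * pd s (C.w l i) u + C.w s l u * C.b j i s u - C.w s i u * C.b j l s u)

/-- `b^{sl}_k ∂_s w^{ij}`. -/
def bw (C : Op n) (l i j k : Fin n) (u : Fin n → ℝ) : ℝ := ∑ s, C.b s l k u * pd s (C.w i j) u

/-- `w^{sl} ∂_s w^{ij}`. -/
def ww (C : Op n) (l i j : Fin n) (u : Fin n → ℝ) : ℝ := ∑ s, C.w s l u * pd s (C.w i j) u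

/-- The Hamiltonian conditions on the coefficients of a regular operator. -/
structure PointConditions (C : Op n) (U : Set (Fin n → ℝ)) : Prop where
  w_skew : ∀ u ∈ U, ∀ i j, C.w i j u + C.w j i u = 0
  gb_symm : ∀ u ∈ U, ∀ l j i, C.gb l j i u = C.gb j l i u
  bb_symm : ∀ u ∈ U, ∀ j l i k, C.bb l j i k u = C.bb i j l k u
  phi_cyclic : ∀ u ∈ U, ∀ j l i, C.phi j l i u = C.phi l i j u
  pd_phi : ∀ u ∈ U, ∀ i j l k, pd k (C.phi i j l) u
    = C.bw l i j k u + C.bw i j l k u + C.bw j l i k u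
  ww_cyclic : ∀ u ∈ U, ∀ i j l, C.ww l i j u + C.ww i j l u + C.ww j l i u = 0

theorem IsRegular.contDiffOn_phi (h : C.IsRegular U) (hU : IsOpen U) (j l i : Fin n) :
    ContDiffOn ℝ ∞ (C.phi j l i) U := by
  refine ContDiffOn.sum fun s _ => ?_
  exact (((h.g_smooth s j).mul ((h.w_smooth l i).pd hU s)).add
    ((h.w_smooth s l).mul (h.b_smooth j i s))).sub ((h.w_smooth s i).mul (h.b_smooth j l s))

theorem IsRegular.contDiffOn_bb (h : C.IsRegular U) (l i j k : Fin n) :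
    ContDiffOn ℝ ∞ (C.bb l i j k) U :=
  ContDiffOn.sum fun s _ => (h.b_smooth s l k).mul (h.b_smooth i j s)

theorem IsRegular.gb_eq (h : C.IsRegular U) (hU : IsOpen U) (l i j : Fin n) (z : JetOver U) :
    DiffAlg.eval z ((h.coeffs hU).gb l i j) = C.gb l i j (z.1.2 0) := by
  simp only [JetAlgebra.Coeffs.gb, coeffs, map_sum, map_mul, DiffAlg.eval_point, gb]

theorem IsRegular.βb_eq (h : C.IsRegular U) (hU : IsOpen U) (l i j : Fin n) :
    (h.coeffs hU).βb l i j
      = ∑ k, DiffAlg.point _ (h.contDiffOn_bb l i j k)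
          * (DiffAlg.jetAlgebra hU).D ((DiffAlg.jetAlgebra hU).u k)
        + ∑ s, DiffAlg.point _ (h.w_smooth s l) * DiffAlg.point _ (h.b_smooth i j s) :=
  DiffAlg.ext_eval fun z => by
    simp only [JetAlgebra.Coeffs.βb, JetAlgebra.Coeffs.β, coeffs, map_sum, map_mul, map_add,
      DiffAlg.eval_point, DiffAlg.eval_D_u, bb, Finset.sum_mul, add_mul, Finset.sum_add_distrib]
    rw [Finset.sum_comm]
    congr 1
    exact Finset.sum_congr rfl fun k _ => Finset.sum_congr rfl fun s _ => by ring

theorem IsRegular.K_eq (h : C.IsRegular U) (hU : IsOpen U) (j l i : Fin n) :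
    (h.coeffs hU).K j l i = DiffAlg.point _ (h.contDiffOn_phi hU j l i)
      + ∑ k, (DiffAlg.point _ (h.contDiffOn_bb l j i k) - DiffAlg.point _ (h.contDiffOn_bb i j l k))
          * (DiffAlg.jetAlgebra hU).D ((DiffAlg.jetAlgebra hU).u k) :=
  DiffAlg.ext_eval fun z => by
    rw [JetAlgebra.Coeffs.K, h.βb_eq, h.βb_eq]
    simp only [JetAlgebra.Coeffs.gw, coeffs, map_sum, map_mul, map_add, map_sub,
      DiffAlg.eval_point, DiffAlg.eval_p_point, phi, sub_mul, Finset.sum_add_distrib,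
      Finset.sum_sub_distrib]
    ring

theorem IsRegular.βw_eq (h : C.IsRegular U) (hU : IsOpen U) (l i j : Fin n) (z : JetOver U) :
    DiffAlg.eval z ((h.coeffs hU).βw l i j)
      = ∑ k, C.bw l i j k (z.1.2 0) * z.1.2 1 k + C.ww l i j (z.1.2 0) := by
  simp only [JetAlgebra.Coeffs.βw, JetAlgebra.Coeffs.β, coeffs, map_sum, map_mul, map_add,
      DiffAlg.eval_point, DiffAlg.eval_D_u, DiffAlg.eval_p_point, bw, ww, Finset.sum_mul, add_mul,
      Finset.sum_add_distrib]
  rw [Finset.sum_comm]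
  congr 1
  exact Finset.sum_congr rfl fun k _ => Finset.sum_congr rfl fun s _ => by ring

/-- The jet over `u` with prescribed first and second derivatives. -/
def jetAt (u v a : Fin n → ℝ) (hu : u ∈ U) : JetOver U :=
  ⟨(0, fun k => if k = 0 then u else if k = 1 then v else a), hu⟩

/-- Both `K` and `βw` are affine in `u_x`, so `u_xx` enters `D_K` only through `D K`. Its
coefficient yields `bb_symm`; then `K` reduces to `phi`, and the parts of `D_K` linear in `u_x` and
free of it are `pd_phi` and `ww_cyclic`. -/
theorem IsRegular.conditions_iff (h : C.IsRegular U) (hU : IsOpen U) :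
    (h.coeffs hU).Conditions ↔ C.PointConditions U := by
  have hK : ∀ j l i (z : JetOver U), DiffAlg.eval z ((h.coeffs hU).K j l i)
      = C.phi j l i (z.1.2 0) + ∑ k, (C.bb l j i k (z.1.2 0) - C.bb i j l k (z.1.2 0)) * z.1.2 1 k := by
    intro j l i z
    rw [h.K_eq]
    simp only [map_add, map_sum, map_mul, map_sub, DiffAlg.eval_point, DiffAlg.eval_D_u]
  constructor
  · intro hc
    have hsingle : ∀ (F : Fin n → ℝ) k, ∑ s, F s * (Pi.single k 1 : Fin n → ℝ) s = F k := by
      intro F k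
      simp [Pi.single_apply]
    have hphi : ∀ u ∈ U, ∀ j l i, C.phi j l i u = C.phi l i j u := by
      intro u hu j l i
      have := congrArg (DiffAlg.eval (jetAt u 0 0 hu)) (hc.K_cyclic j l i)
      simpa [hK, jetAt] using this
    have hbbc : ∀ u ∈ U, ∀ j l i k, C.bb l j i k u - C.bb i j l k u
        = C.bb i l j k u - C.bb j l i k u := by
      intro u hu j l i k
      have := congrArg (DiffAlg.eval (jetAt u (Pi.single k 1) 0 hu)) (hc.K_cyclic j l i)
      rw [hK, hK] at this
      simp only [jetAt, if_true, one_ne_zero, if_false, hsingle, hphi u hu j l i] at this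
      linarith
    have hDK : ∀ j l i (z : JetOver U),
        DiffAlg.eval z ((DiffAlg.jetAlgebra hU).D ((h.coeffs hU).K j l i))
        = ∑ s, z.1.2 1 s * pd s (C.phi j l i) (z.1.2 0)
          + (∑ k, (C.bb l j i k (z.1.2 0) - C.bb i j l k (z.1.2 0)) * z.1.2 2 k
          + ∑ k, z.1.2 1 k * (∑ s, z.1.2 1 s * pd s (C.bb l j i k) (z.1.2 0)
              - ∑ s, z.1.2 1 s * pd s (C.bb i j l k) (z.1.2 0))) := by
      intro j l i z
      rw [h.K_eq]
      simp only [map_add, map_sum, map_mul, map_sub, DiffAlg.eval_point, DiffAlg.eval_D_u,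
        Derivation.leibniz, smul_eq_mul, DiffAlg.eval_D_point, DiffAlg.eval_D_D_u,
        Finset.sum_add_distrib]
    have hww : ∀ u ∈ U, ∀ i j l, C.ww l i j u + C.ww i j l u + C.ww j l i u = 0 := by
      intro u hu i j l
      have := congrArg (DiffAlg.eval (jetAt u 0 0 hu)) (hc.D_K i j l)
      rw [hDK, map_add, map_add, h.βw_eq, h.βw_eq, h.βw_eq] at this
      simp [jetAt] at this
      linarith
    -- At `u_x = 0`, `u_xx = e_k` the left side is a single coefficient of `u_xx`, and the right
    -- side is the vanishing cyclic sum of `ww`.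
    have hbb : ∀ u ∈ U, ∀ j l i k, C.bb l j i k u = C.bb i j l k u := by
      intro u hu j l i k
      have := congrArg (DiffAlg.eval (jetAt u 0 (Pi.single k 1) hu)) (hc.D_K j l i)
      rw [hDK, map_add, map_add, h.βw_eq, h.βw_eq, h.βw_eq] at this
      simp only [jetAt, if_true, one_ne_zero, if_false, hsingle, Pi.zero_apply, zero_mul, mul_zero,
        Finset.sum_const_zero, zero_add, add_zero, OfNat.ofNat_ne_zero, OfNat.ofNat_ne_one] at this
      linarith [hww u hu j l i]
    refine ⟨fun u hu i j => ?_, fun u hu l j i => ?_, hbb, hphi, fun u hu i j l k => ?_, hww⟩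
    · have := congrArg (DiffAlg.eval (jetAt u 0 0 hu)) (hc.w_skew i j)
      simpa [IsRegular.coeffs, DiffAlg.eval_point, jetAt] using this
    · have := congrArg (DiffAlg.eval (jetAt u 0 0 hu)) (hc.gb_symm l j i)
      simpa [h.gb_eq, jetAt] using this
    · have h1 : (h.coeffs hU).K i j l = DiffAlg.point _ (h.contDiffOn_phi hU i j l) :=
        DiffAlg.ext_eval fun z => by
          rw [hK, DiffAlg.eval_point]
          simp [hbb _ z.2 i j l]
      have := congrArg (DiffAlg.eval (jetAt u (Pi.single k 1) 0 hu)) (hc.D_K i j l)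
      rw [h1, DiffAlg.eval_D_point, map_add, map_add, h.βw_eq, h.βw_eq, h.βw_eq] at this
      simp only [mul_comm _ (pd _ _ _), jetAt, if_true, one_ne_zero, if_false, hsingle] at this
      linarith [hww u hu i j l]
  · intro hc
    have h1 : ∀ i j l, (h.coeffs hU).K i j l = DiffAlg.point _ (h.contDiffOn_phi hU i j l) :=
      fun i j l => DiffAlg.ext_eval fun z => by
        rw [hK, DiffAlg.eval_point]
        simp [hc.bb_symm _ z.2 i j l]
    refine ⟨fun i j => DiffAlg.ext_eval fun z => ?_, fun l j i => DiffAlg.ext_eval fun z => ?_,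
      fun j l i => DiffAlg.ext_eval fun z => ?_, fun i j l => DiffAlg.ext_eval fun z => ?_⟩
    · simpa [IsRegular.coeffs, DiffAlg.eval_point] using hc.w_skew _ z.2 i j
    · rw [h.gb_eq, h.gb_eq, hc.gb_symm _ z.2]
    · rw [h1, h1, DiffAlg.eval_point, DiffAlg.eval_point, hc.phi_cyclic _ z.2]
    · rw [h1, DiffAlg.eval_D_point, map_add, map_add, h.βw_eq, h.βw_eq, h.βw_eq]
      have := hc.ww_cyclic _ z.2 i j l
      simp only [hc.pd_phi _ z.2, mul_comm (z.1.2 1 _), add_mul, Finset.sum_add_distrib]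
      linarith

theorem IsRegular.isHamiltonian_iff_pointConditions (h : C.IsRegular U) (hU : IsOpen U) :
    C.IsHamiltonian U ↔ C.PointConditions U :=
  (h.isHamiltonian_iff hU).trans ((DiffAlg.isHam_iff hU _).trans (h.conditions_iff hU))

end Op

end

/-! ### Calculus of partial derivatives on `U`. -/

section

variable {n : ℕ} {U : Set (Fin n → ℝ)}

section PartialDerivatives

variable {φ ψ : (Fin n → ℝ) → ℝ} {u : Fin n → ℝ}

theorem _root_.ContDiffOn.differentiableAt_of_isOpen (hφ : ContDiffOn ℝ ∞ φ U) (hU : IsOpen U)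
    (hu : u ∈ U) : DifferentiableAt ℝ φ u :=
  (hφ.contDiffAt (hU.mem_nhds hu)).differentiableAt (by simp)

theorem pd_congr (hU : IsOpen U) (h : ∀ u ∈ U, φ u = ψ u) (s : Fin n) (hu : u ∈ U) :
    pd s φ u = pd s ψ u := by
  have : φ =ᶠ[nhds u] ψ := Filter.eventuallyEq_of_mem (hU.mem_nhds hu) h
  rw [pd, this.fderiv_eq, pd]

theorem pd_add (hφ : DifferentiableAt ℝ φ u) (hψ : DifferentiableAt ℝ ψ u) (s : Fin n) :
    pd s (fun u => φ u + ψ u) u = pd s φ u + pd s ψ u := by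
  rw [pd, fderiv_fun_add hφ hψ]; rfl

theorem pd_sub (hφ : DifferentiableAt ℝ φ u) (hψ : DifferentiableAt ℝ ψ u) (s : Fin n) :
    pd s (fun u => φ u - ψ u) u = pd s φ u - pd s ψ u := by
  rw [pd, fderiv_fun_sub hφ hψ]; rfl

theorem pd_const_mul (hφ : DifferentiableAt ℝ φ u) (r : ℝ) (s : Fin n) :
    pd s (fun u => r * φ u) u = r * pd s φ u := by
  rw [pd, fderiv_const_mul hφ]; rfl

theorem pd_mul (hφ : DifferentiableAt ℝ φ u) (hψ : DifferentiableAt ℝ ψ u) (s : Fin n) :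
    pd s (fun u => φ u * ψ u) u = φ u * pd s ψ u + ψ u * pd s φ u := by
  rw [pd, fderiv_fun_mul hφ hψ]; rfl

theorem pd_sum {ι : Type*} (S : Finset ι) {F : ι → (Fin n → ℝ) → ℝ}
    (hF : ∀ i ∈ S, DifferentiableAt ℝ (F i) u) (s : Fin n) :
    pd s (fun u => ∑ i ∈ S, F i u) u = ∑ i ∈ S, pd s (F i) u := by
  rw [pd, fderiv_fun_sum hF, sum_apply]; rfl

theorem pd_const (r : ℝ) (s : Fin n) : pd s (fun _ => r) u = 0 := by
  rw [pd, fderiv_fun_const]; rfl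

theorem pd_comm (hU : IsOpen U) (hφ : ContDiffOn ℝ ∞ φ U) (s t : Fin n) (hu : u ∈ U) :
    pd s (pd t φ) u = pd t (pd s φ) u := by
  have hd : DifferentiableAt ℝ (fderiv ℝ φ) u :=
    ((hφ.fderiv_of_isOpen (m := ∞) hU (by simp)).contDiffAt (hU.mem_nhds hu)).differentiableAt
      (by simp)
  have hs : IsSymmSndFDerivAt ℝ φ u := (hφ.contDiffAt (hU.mem_nhds hu)).isSymmSndFDerivAt
    (by simpa using WithTop.coe_le_coe.2 (le_top : (2 : ℕ∞) ≤ ⊤))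
  have key : ∀ s t : Fin n, pd s (pd t φ) u
      = fderiv ℝ (fderiv ℝ φ) u (Pi.single s 1) (Pi.single t 1) := by
    intro s t
    have : pd t φ = fun u => fderiv ℝ φ u (Pi.single t 1) := rfl
    rw [pd, this, fderiv_clm_apply hd (by fun_prop)]
    simp
  rw [key, key, hs.eq]

theorem pd_comm₃ (hU : IsOpen U) (hφ : ContDiffOn ℝ ∞ φ U) (r s t : Fin n) (hu : u ∈ U) :
    pd r (pd s (pd t φ)) u = pd t (pd s (pd r φ)) u := by
  rw [pd_congr hU (fun u hu => pd_comm hU hφ s t hu) r hu, pd_comm hU (hφ.pd hU s) r t hu,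
    pd_congr hU (fun u hu => pd_comm hU hφ r s hu) t hu]

theorem contDiff_affineTensor (c : Fin n → Fin n → Fin n → ℝ) (f : Fin n → Fin n → ℝ)
    (i j : Fin n) : ContDiff ℝ ∞ (affineTensor c f i j) := by
  unfold affineTensor
  fun_prop

theorem pd_affineTensor (c : Fin n → Fin n → Fin n → ℝ) (f : Fin n → Fin n → ℝ)
    (i j s : Fin n) (u : Fin n → ℝ) : pd s (affineTensor c f i j) u = c i j s := by
  have h : ∀ k : Fin n, HasFDerivAt (fun u : Fin n → ℝ => u k)
      (ContinuousLinearMap.proj (R := ℝ) (φ := fun _ : Fin n => ℝ) k) u :=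
    fun k => hasFDerivAt_apply k u
  have h2 : HasFDerivAt (affineTensor c f i j)
      (∑ k, c i j k • ContinuousLinearMap.proj (R := ℝ) (φ := fun _ : Fin n => ℝ) k) u :=
    (HasFDerivAt.fun_sum fun k _ => (h k).const_mul (c i j k)).add_const (f i j)
  rw [pd, h2.fderiv]
  simp [Pi.single_apply]

end PartialDerivatives

/-! ### Compatibility by polarization. -/

namespace Op

variable {A B : Op n}

theorem IsRegular.lincomb (hU : IsOpen U) (hA : A.IsRegular U) (hB : B.IsRegular U) (μ ν : ℝ) :
    (lincomb μ A ν B).IsRegular U where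
  g_smooth i j := (contDiffOn_const.mul (hA.g_smooth i j)).add
    (contDiffOn_const.mul (hB.g_smooth i j))
  b_smooth i j k := (contDiffOn_const.mul (hA.b_smooth i j k)).add
    (contDiffOn_const.mul (hB.b_smooth i j k))
  w_smooth i j := (contDiffOn_const.mul (hA.w_smooth i j)).add
    (contDiffOn_const.mul (hB.w_smooth i j))
  g_symm u hu i j := by simp only [Op.lincomb, hA.g_symm u hu i j, hB.g_symm u hu i j]
  g_deriv u hu i j k := by
    have h1 := (hA.g_smooth i j).differentiableAt_of_isOpen hU hu
    have h2 := (hB.g_smooth i j).differentiableAt_of_isOpen hU hu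
    simp only [Op.lincomb]
    rw [pd_add (h1.const_mul μ) (h2.const_mul ν), pd_const_mul h1, pd_const_mul h2,
      hA.g_deriv u hu, hB.g_deriv u hu]
    ring
  b_closed u hu i j k s := by
    have h1 := fun k => (hA.b_smooth i j k).differentiableAt_of_isOpen hU hu
    have h2 := fun k => (hB.b_smooth i j k).differentiableAt_of_isOpen hU hu
    simp only [Op.lincomb]
    rw [pd_add ((h1 k).const_mul μ) ((h2 k).const_mul ν), pd_const_mul (h1 k),
      pd_const_mul (h2 k), pd_add ((h1 s).const_mul μ) ((h2 s).const_mul ν), pd_const_mul (h1 s),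
      pd_const_mul (h2 s), hA.b_closed u hu, hB.b_closed u hu]

/-- Polarization of `gb`. -/
def gbM (A B : Op n) (l i j : Fin n) (u : Fin n → ℝ) : ℝ :=
  ∑ s, (A.g s l u * B.b i j s u + B.g s l u * A.b i j s u)

/-- Polarization of `bb`. -/
def bbM (A B : Op n) (l i j k : Fin n) (u : Fin n → ℝ) : ℝ :=
  ∑ s, (A.b s l k u * B.b i j s u + B.b s l k u * A.b i j s u)

/-- Polarization of `phi`. -/
def phiM (A B : Op n) (j l i : Fin n) (u : Fin n → ℝ) : ℝ :=
  ∑ s, (A.g s j u * pd s (B.w l i) u + A.w s l u * B.b j i s u - A.w s i u * B.b j l s u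
    + (B.g s j u * pd s (A.w l i) u + B.w s l u * A.b j i s u - B.w s i u * A.b j l s u))

/-- Polarization of `bw`. -/
def bwM (A B : Op n) (l i j k : Fin n) (u : Fin n → ℝ) : ℝ :=
  ∑ s, (A.b s l k u * pd s (B.w i j) u + B.b s l k u * pd s (A.w i j) u)

/-- Polarization of `ww`. -/
def wwM (A B : Op n) (l i j : Fin n) (u : Fin n → ℝ) : ℝ :=
  ∑ s, (A.w s l u * pd s (B.w i j) u + B.w s l u * pd s (A.w i j) u)

/-- Polarization of the Hamiltonian conditions. -/
structure MixedConditions (A B : Op n) (U : Set (Fin n → ℝ)) : Prop where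
  gb_symm : ∀ u ∈ U, ∀ l j i, gbM A B l j i u = gbM A B j l i u
  bb_symm : ∀ u ∈ U, ∀ j l i k, bbM A B l j i k u = bbM A B i j l k u
  phi_cyclic : ∀ u ∈ U, ∀ j l i, phiM A B j l i u = phiM A B l i j u
  pd_phi : ∀ u ∈ U, ∀ i j l k, pd k (phiM A B i j l) u
    = bwM A B l i j k u + bwM A B i j l k u + bwM A B j l i k u
  ww_cyclic : ∀ u ∈ U, ∀ i j l, wwM A B l i j u + wwM A B i j l u + wwM A B j l i u = 0

section Polarization

variable (A B) (μ ν : ℝ) (u : Fin n → ℝ)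

theorem gb_lincomb (l i j : Fin n) : (Op.lincomb μ A ν B).gb l i j u
    = μ ^ 2 * A.gb l i j u + μ * ν * gbM A B l i j u + ν ^ 2 * B.gb l i j u := by
  simp only [gb, gbM, Op.lincomb, Finset.mul_sum, ← Finset.sum_add_distrib]
  exact Finset.sum_congr rfl fun s _ => by ring

theorem bb_lincomb (l i j k : Fin n) : (Op.lincomb μ A ν B).bb l i j k u
    = μ ^ 2 * A.bb l i j k u + μ * ν * bbM A B l i j k u + ν ^ 2 * B.bb l i j k u := by
  simp only [bb, bbM, Op.lincomb, Finset.mul_sum, ← Finset.sum_add_distrib]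
  exact Finset.sum_congr rfl fun s _ => by ring

variable {A B} {u}

theorem pd_w_lincomb (hU : IsOpen U) (hA : A.IsRegular U) (hB : B.IsRegular U) (hu : u ∈ U)
    (i j s : Fin n) : pd s ((Op.lincomb μ A ν B).w i j) u
      = μ * pd s (A.w i j) u + ν * pd s (B.w i j) u := by
  have h1 := (hA.w_smooth i j).differentiableAt_of_isOpen hU hu
  have h2 := (hB.w_smooth i j).differentiableAt_of_isOpen hU hu
  simp only [Op.lincomb]
  rw [pd_add (h1.const_mul μ) (h2.const_mul ν), pd_const_mul h1, pd_const_mul h2]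

theorem phi_lincomb (hU : IsOpen U) (hA : A.IsRegular U) (hB : B.IsRegular U) (hu : u ∈ U)
    (l i j : Fin n) : (Op.lincomb μ A ν B).phi l i j u
    = μ ^ 2 * A.phi l i j u + μ * ν * phiM A B l i j u + ν ^ 2 * B.phi l i j u := by
  simp only [phi, phiM, pd_w_lincomb μ ν hU hA hB hu, Finset.mul_sum, ← Finset.sum_add_distrib]
  exact Finset.sum_congr rfl fun s _ => by simp only [Op.lincomb]; ring

theorem bw_lincomb (hU : IsOpen U) (hA : A.IsRegular U) (hB : B.IsRegular U) (hu : u ∈ U)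
    (l i j k : Fin n) : (Op.lincomb μ A ν B).bw l i j k u
    = μ ^ 2 * A.bw l i j k u + μ * ν * bwM A B l i j k u + ν ^ 2 * B.bw l i j k u := by
  simp only [bw, bwM, pd_w_lincomb μ ν hU hA hB hu, Finset.mul_sum, ← Finset.sum_add_distrib]
  exact Finset.sum_congr rfl fun s _ => by simp only [Op.lincomb]; ring

theorem ww_lincomb (hU : IsOpen U) (hA : A.IsRegular U) (hB : B.IsRegular U) (hu : u ∈ U)
    (l i j : Fin n) : (Op.lincomb μ A ν B).ww l i j u
    = μ ^ 2 * A.ww l i j u + μ * ν * wwM A B l i j u + ν ^ 2 * B.ww l i j u := by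
  simp only [ww, wwM, pd_w_lincomb μ ν hU hA hB hu, Finset.mul_sum, ← Finset.sum_add_distrib]
  exact Finset.sum_congr rfl fun s _ => by simp only [Op.lincomb]; ring

theorem contDiffOn_phiM (hU : IsOpen U) (hA : A.IsRegular U) (hB : B.IsRegular U)
    (j l i : Fin n) : ContDiffOn ℝ ∞ (phiM A B j l i) U := by
  have key : ∀ {A B : Op n}, A.IsRegular U → B.IsRegular U → ∀ s, ContDiffOn ℝ ∞ (fun u =>
      A.g s j u * pd s (B.w l i) u + A.w s l u * B.b j i s u - A.w s i u * B.b j l s u) U :=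
    fun hA hB s => (((hA.g_smooth s j).mul ((hB.w_smooth l i).pd hU s)).add
      ((hA.w_smooth s l).mul (hB.b_smooth j i s))).sub ((hA.w_smooth s i).mul (hB.b_smooth j l s))
  exact ContDiffOn.sum fun s _ => (key hA hB s).add (key hB hA s)

theorem pd_phi_lincomb (hU : IsOpen U) (hA : A.IsRegular U) (hB : B.IsRegular U) (hu : u ∈ U)
    (l i j k : Fin n) : pd k ((Op.lincomb μ A ν B).phi l i j) u
    = μ ^ 2 * pd k (A.phi l i j) u + μ * ν * pd k (phiM A B l i j) u
      + ν ^ 2 * pd k (B.phi l i j) u := by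
  have h1 := (hA.contDiffOn_phi hU l i j).differentiableAt_of_isOpen hU hu
  have h2 := (contDiffOn_phiM hU hA hB l i j).differentiableAt_of_isOpen hU hu
  have h3 := (hB.contDiffOn_phi hU l i j).differentiableAt_of_isOpen hU hu
  rw [pd_congr hU (fun u hu => phi_lincomb μ ν hU hA hB hu l i j) k hu,
    pd_add ((h1.const_mul _).fun_add (h2.const_mul _)) (h3.const_mul _),
    pd_add (h1.const_mul _) (h2.const_mul _), pd_const_mul h1, pd_const_mul h2, pd_const_mul h3]

theorem PointConditions.lincomb (hU : IsOpen U) (hA : A.IsRegular U) (hB : B.IsRegular U)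
    (cA : A.PointConditions U) (cB : B.PointConditions U) (cM : MixedConditions A B U) :
    (Op.lincomb μ A ν B).PointConditions U where
  w_skew u hu i j := by
    simp only [Op.lincomb]
    linear_combination μ * cA.w_skew u hu i j + ν * cB.w_skew u hu i j
  gb_symm u hu l j i := by
    rw [gb_lincomb, gb_lincomb, cA.gb_symm u hu, cB.gb_symm u hu, cM.gb_symm u hu]
  bb_symm u hu j l i k := by
    rw [bb_lincomb, bb_lincomb, cA.bb_symm u hu, cB.bb_symm u hu, cM.bb_symm u hu]
  phi_cyclic u hu j l i := by
    rw [phi_lincomb μ ν hU hA hB hu, phi_lincomb μ ν hU hA hB hu, cA.phi_cyclic u hu,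
      cB.phi_cyclic u hu, cM.phi_cyclic u hu]
  pd_phi u hu i j l k := by
    rw [pd_phi_lincomb μ ν hU hA hB hu, cA.pd_phi u hu, cB.pd_phi u hu, cM.pd_phi u hu]
    simp only [bw_lincomb μ ν hU hA hB hu]
    ring
  ww_cyclic u hu i j l := by
    simp only [ww_lincomb μ ν hU hA hB hu]
    linear_combination μ ^ 2 * cA.ww_cyclic u hu i j l + μ * ν * cM.ww_cyclic u hu i j l
      + ν ^ 2 * cB.ww_cyclic u hu i j l

theorem PointConditions.mixed (hU : IsOpen U) (hA : A.IsRegular U) (hB : B.IsRegular U)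
    (cA : A.PointConditions U) (cB : B.PointConditions U)
    (cS : (Op.lincomb 1 A 1 B).PointConditions U) : MixedConditions A B U where
  gb_symm u hu l j i := by
    have h := cS.gb_symm u hu l j i
    rw [gb_lincomb, gb_lincomb, cA.gb_symm u hu, cB.gb_symm u hu] at h
    linarith
  bb_symm u hu j l i k := by
    have h := cS.bb_symm u hu j l i k
    rw [bb_lincomb, bb_lincomb, cA.bb_symm u hu, cB.bb_symm u hu] at h
    linarith
  phi_cyclic u hu j l i := by
    have h := cS.phi_cyclic u hu j l i
    rw [phi_lincomb 1 1 hU hA hB hu, phi_lincomb 1 1 hU hA hB hu, cA.phi_cyclic u hu,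
      cB.phi_cyclic u hu] at h
    linarith
  pd_phi u hu i j l k := by
    have h := cS.pd_phi u hu i j l k
    rw [pd_phi_lincomb 1 1 hU hA hB hu, cA.pd_phi u hu, cB.pd_phi u hu] at h
    simp only [bw_lincomb 1 1 hU hA hB hu] at h
    linarith
  ww_cyclic u hu i j l := by
    have h := cS.ww_cyclic u hu i j l
    simp only [ww_lincomb 1 1 hU hA hB hu] at h
    linarith [cA.ww_cyclic u hu i j l, cB.ww_cyclic u hu i j l]

/-- Skewness of `w` is linear and the other conditions are quadratic forms in the operator. The
combination `(0, 1)` gives the conditions for `B`, and `(1, 1)` then isolates the cross terms;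
together with those for `A` they give every `(μ, ν)`. -/
theorem compatible_iff (hU : IsOpen U) (hA : A.IsRegular U) (hB : B.IsRegular U)
    (cA : A.PointConditions U) :
    Compatible U A B ↔ B.PointConditions U ∧ MixedConditions A B U := by
  have hreg := fun μ ν : ℝ => hA.lincomb hU hB μ ν
  constructor
  · intro h
    have hB' : Op.lincomb 0 A 1 B = B := by simp [Op.lincomb]
    have cB : B.PointConditions U := by
      have := (hreg 0 1).isHamiltonian_iff_pointConditions hU |>.1 (h 0 1)
      rwa [hB'] at this
    exact ⟨cB, PointConditions.mixed hU hA hB cA cB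
      ((hreg 1 1).isHamiltonian_iff_pointConditions hU |>.1 (h 1 1))⟩
  · rintro ⟨cB, cM⟩ μ ν
    exact (hreg μ ν).isHamiltonian_iff_pointConditions hU |>.2 (.lincomb μ ν hU hA hB cA cB cM)

end Polarization

end Op

end

/-! ### The five tensors as Hamiltonian and mixed conditions in Darboux coordinates. -/

section

variable {n : ℕ} {U : Set (Fin n → ℝ)} {η : Matrix (Fin n) (Fin n) ℝ}
  {c : Fin n → Fin n → Fin n → ℝ} {f : Fin n → Fin n → ℝ} {h : Fin n → (Fin n → ℝ) → ℝ}
  {w : Fin n → Fin n → (Fin n → ℝ) → ℝ}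

theorem isRegular_darbouxOp (hη : η.IsSymm) : (darbouxOp η c f).IsRegular U where
  g_smooth i j := contDiffOn_const
  b_smooth i j k := contDiffOn_const
  w_smooth i j := (contDiff_affineTensor c f i j).contDiffOn
  g_symm u _ i j := (hη.apply i j).symm
  g_deriv u _ i j k := by simp [darbouxOp, pd_const]
  b_closed u _ i j k s := by simp [darbouxOp, pd_const]

theorem pd_mokhovConn (hU : IsOpen U) (hh : ∀ i, ContDiffOn ℝ ∞ (h i) U) (i j k m : Fin n)
    {u : Fin n → ℝ} (hu : u ∈ U) :
    pd m (mokhovConn η h i j k) u = ∑ s, η i s * pd m (pd s (pd k (h j))) u := by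
  have hd : ∀ s, DifferentiableAt ℝ (pd s (pd k (h j))) u :=
    fun s => (((hh j).pd hU k).pd hU s).differentiableAt_of_isOpen hU hu
  unfold mokhovConn
  rw [pd_sum _ fun s _ => (hd s).const_mul _]
  exact Finset.sum_congr rfl fun s _ => pd_const_mul (hd s) _ _

/-- Here `b^{ij}_k` is `∂_k` of `η^{is} ∂_s h^j`, hence closed in `k`, and `g` is the symmetrization
of that same expression. -/
theorem isRegular_mokhovOp (hU : IsOpen U) (hh : ∀ i, ContDiffOn ℝ ∞ (h i) U)
    (hw : ∀ i j, ContDiffOn ℝ ∞ (w i j) U) : (mokhovOp η h w).IsRegular U where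
  g_smooth i j := by
    simp only [mokhovOp]
    unfold mokhovMetric
    exact ContDiffOn.sum fun s _ => (contDiffOn_const.mul ((hh j).pd hU s)).add
      (contDiffOn_const.mul ((hh i).pd hU s))
  b_smooth i j k := by
    simp only [mokhovOp]
    unfold mokhovConn
    exact ContDiffOn.sum fun s _ => contDiffOn_const.mul (((hh j).pd hU k).pd hU s)
  w_smooth := hw
  g_symm u _ i j := by
    simp only [mokhovOp, mokhovMetric]
    exact Finset.sum_congr rfl fun s _ => add_comm _ _
  g_deriv u hu i j k := by
    have hd : ∀ i s, DifferentiableAt ℝ (pd s (h i)) u :=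
      fun i s => ((hh i).pd hU s).differentiableAt_of_isOpen hU hu
    simp only [mokhovOp, mokhovConn]
    unfold mokhovMetric
    rw [pd_sum _ fun s _ => ((hd j s).const_mul _).fun_add ((hd i s).const_mul _),
      ← Finset.sum_add_distrib]
    refine Finset.sum_congr rfl fun s _ => ?_
    rw [pd_add ((hd j s).const_mul _) ((hd i s).const_mul _), pd_const_mul (hd j s),
      pd_const_mul (hd i s), pd_comm hU (hh j) s k hu, pd_comm hU (hh i) s k hu]
  b_closed u hu i j k s := by
    simp only [mokhovOp]
    rw [pd_mokhovConn hU hh i j k s hu, pd_mokhovConn hU hh i j s k hu]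
    exact Finset.sum_congr rfl fun t _ => by rw [pd_comm₃ hU (hh j) s t k hu]

theorem eq_zero_of_sum_mul_eq_zero (hdet : η.det ≠ 0) {X : Fin n → ℝ}
    (hX : ∀ p, ∑ q, η p q * X q = 0) : X = 0 :=
  Matrix.eq_zero_of_mulVec_eq_zero hdet (funext hX)

/-- `gb` does not see the zero-order part, so `w` is free: the identity serves both `B` and its
first-order part. -/
theorem tensorG_eq (i j k : Fin n) (u : Fin n → ℝ) :
    tensorG η h i j k u = (mokhovOp η h w).gb i j k u - (mokhovOp η h w).gb j i k u := by
  have key : ∀ i j, ∑ l, ∑ s, (∑ p, (η i p * pd p (h l) u + η l p * pd p (h i) u))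
      * η j s * pd s (pd l (h k)) u = (mokhovOp η h w).gb i j k u := by
    intro i j
    simp only [Op.gb, mokhovOp, mokhovConn, Finset.mul_sum]
    refine Finset.sum_congr rfl fun l _ => Finset.sum_congr rfl fun s _ => ?_
    rw [mul_assoc]
    congr 1
    exact Finset.sum_congr rfl fun p _ => add_comm _ _
  rw [tensorG, key, key]

/-- `R` has a lower index where `bb` has an upper one. Contraction with `η` raises it, reversibly
since `η` is invertible. -/
theorem sum_mul_tensorR (p j r k : Fin n) (u : Fin n → ℝ) :
    ∑ q, η p q * tensorR η h j r q k u
      = (mokhovOp η h w).bb r p j k u - (mokhovOp η h w).bb j p r k u := by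
  have key : ∀ j r : Fin n, ∑ q, η p q * ∑ l, ∑ m, pd q (pd l (h j)) u * η l m * pd m (pd k (h r)) u
      = (mokhovOp η h w).bb r p j k u := by
    intro j r
    simp only [Op.bb, mokhovOp, mokhovConn, Finset.mul_sum, Finset.sum_mul]
    rw [Finset.sum_comm]
    exact Finset.sum_congr rfl fun l _ => Finset.sum_congr rfl fun q _ =>
      Finset.sum_congr rfl fun m _ => by ring
  rw [← key, ← key]
  simp only [tensorR, Finset.sum_sub_distrib, mul_sub]

theorem tensorL_eq (i j k : Fin n) (u : Fin n → ℝ) :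
    tensorL c f w i j k u = Op.wwM (darbouxOp η c f) (mokhovOp η h w) k i j u
      + Op.wwM (darbouxOp η c f) (mokhovOp η h w) i j k u
      + Op.wwM (darbouxOp η c f) (mokhovOp η h w) j k i u := by
  simp only [tensorL, Op.wwM, ← Finset.sum_add_distrib]
  refine Finset.sum_congr rfl fun s _ => ?_
  simp only [darbouxOp, pd_affineTensor, mokhovOp]
  simp only [affineTensor]
  ring

theorem phiM_eq (j l i : Fin n) (u : Fin n → ℝ) :
    Op.phiM (darbouxOp η c f) (mokhovOp η h w) j l i u
      = ∑ s, (η s j * pd s (w l i) u + affineTensor c f s l u * mokhovConn η h j i s u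
        - affineTensor c f s i u * mokhovConn η h j l s u + mokhovMetric η h s j u * c l i s) := by
  refine Finset.sum_congr rfl fun s _ => ?_
  simp only [darbouxOp, pd_affineTensor, mokhovOp]
  ring

/-- The two groups of terms in `P` are exchanged by `i ↔ j`. Skewness of `ω_A` reconciles `ω^{js}`
and `ω^{is}` with the index order used in `phiM`. -/
theorem tensorP_eq (hη : η.IsSymm) {u : Fin n → ℝ}
    (hskew : ∀ i j, affineTensor c f i j u = - affineTensor c f j i u) (i j k : Fin n) :
    tensorP η c f h w i j k u = Op.phiM (darbouxOp η c f) (mokhovOp η h w) i j k u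
      + Op.phiM (darbouxOp η c f) (mokhovOp η h w) j i k u := by
  rw [phiM_eq, phiM_eq, ← Finset.sum_add_distrib, tensorP]
  have hc : ∀ i j s, ∑ l, η i l * pd l (pd s (h j)) u = mokhovConn η h i j s u := fun i j s => rfl
  have hg : ∀ i s, ∑ l, (η i l * pd l (h s) u + η s l * pd l (h i) u) = mokhovMetric η h s i u :=
    fun i s => Finset.sum_congr rfl fun l _ => add_comm _ _
  have ha : ∀ i j, ∑ m, c i j m * u m + f i j = affineTensor c f i j u := fun i j => rfl
  simp only [hc, hg, ha]
  refine Finset.sum_congr rfl fun s _ => ?_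
  rw [hη.apply s i, hη.apply s j, hskew s j, hskew s i]
  ring

/-- Contraction with `η` raises the first lower index of `S`. Most terms then match those of `∂_r
phiM` directly; the terms in which `c` carries the contracted index become `bwM` terms by the total
antisymmetry of `η^{is} c^{jk}_s`, which comes from the Hamiltonian property of `A`. -/
theorem sum_mul_tensorS (hU : IsOpen U) (hη : η.IsSymm) (hh : ∀ i, ContDiffOn ℝ ∞ (h i) U)
    (hw : ∀ i j, ContDiffOn ℝ ∞ (w i j) U) (cA : (darbouxOp η c f).PointConditions U)
    {u : Fin n → ℝ} (hu : u ∈ U) (p j k r : Fin n) :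
    ∑ q, η p q * tensorS c f h w j k q r u
      = pd r (Op.phiM (darbouxOp η c f) (mokhovOp η h w) p j k) u
        - (Op.bwM (darbouxOp η c f) (mokhovOp η h w) k p j r u
          + Op.bwM (darbouxOp η c f) (mokhovOp η h w) p j k r u
          + Op.bwM (darbouxOp η c f) (mokhovOp η h w) j k p r u) := by
  have hskewU : ∀ u ∈ U, ∀ i j, affineTensor c f i j u = - affineTensor c f j i u :=
    fun u hu i j => eq_neg_of_add_eq_zero_left (cA.w_skew u hu i j)
  have hskew := hskewU u hu
  have haff : ∀ i j, DifferentiableAt ℝ (affineTensor c f i j) u := fun i j =>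
    (contDiff_affineTensor c f i j).differentiable (by simp) u
  -- Skewness of the affine tensor holds on an open set, so it may be differentiated there.
  have hcskew : ∀ i j s, c i j s = - c j i s := by
    intro i j s
    have h1 := pd_congr hU (fun u hu => hskewU u hu i j) s hu
    have h2 : pd s (fun u => - affineTensor c f j i u) u = - pd s (affineTensor c f j i) u := by
      have := pd_const_mul (haff j i) (-1) s
      simpa using this
    rwa [h2, pd_affineTensor, pd_affineTensor] at h1
  have hphiA : ∀ i j k, (darbouxOp η c f).phi i j k u = ∑ s, η s i * c j k s := by
    intro i j k
    refine Finset.sum_congr rfl fun s _ => ?_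
    simp only [darbouxOp, pd_affineTensor]
    ring
  -- total antisymmetry of `η^{is} c^{jk}_s`
  have hanti : ∀ i j k, ∑ s, η i s * c j k s = - ∑ s, η s j * c i k s := by
    intro i j k
    have h1 := cA.phi_cyclic u hu i j k
    rw [hphiA, hphiA] at h1
    rw [← Finset.sum_neg_distrib]
    calc ∑ s, η i s * c j k s = ∑ s, η s i * c j k s :=
          Finset.sum_congr rfl fun s _ => by rw [hη.apply s i]
      _ = _ := h1
      _ = _ := Finset.sum_congr rfl fun s _ => by rw [hcskew k i]; ring
  have hbd : ∀ i j k, DifferentiableAt ℝ (mokhovConn η h i j k) u := fun i j k =>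
    ((isRegular_mokhovOp (η := η) hU hh hw).b_smooth i j k).differentiableAt_of_isOpen hU hu
  have hgd : ∀ i j, DifferentiableAt ℝ (mokhovMetric η h i j) u := fun i j =>
    ((isRegular_mokhovOp (η := η) hU hh hw).g_smooth i j).differentiableAt_of_isOpen hU hu
  have hwd : ∀ i j s, DifferentiableAt ℝ (pd s (w i j)) u := fun i j s =>
    ((hw i j).pd hU s).differentiableAt_of_isOpen hU hu
  have hpdg : ∀ s, pd r (mokhovMetric η h s p) u = mokhovConn η h s p r u + mokhovConn η h p s r u :=
    fun s => (isRegular_mokhovOp (η := η) hU hh hw).g_deriv u hu s p r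
  have hpd : pd r (Op.phiM (darbouxOp η c f) (mokhovOp η h w) p j k) u
      = ∑ s, (η s p * pd r (pd s (w j k)) u
        + (affineTensor c f s j u * pd r (mokhovConn η h p k s) u + mokhovConn η h p k s u * c s j r)
        - (affineTensor c f s k u * pd r (mokhovConn η h p j s) u + mokhovConn η h p j s u * c s k r)
        + (mokhovConn η h s p r u + mokhovConn η h p s r u) * c j k s) := by
    rw [show Op.phiM (darbouxOp η c f) (mokhovOp η h w) p j k = _ from funext (phiM_eq p j k)]
    have d1 := fun s => (hwd j k s).const_mul (η s p)
    have d2 := fun s => (haff s j).fun_mul (hbd p k s)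
    have d3 := fun s => (haff s k).fun_mul (hbd p j s)
    have d4 := fun s => (hgd s p).mul_const (c j k s)
    rw [pd_sum _ fun s _ => (((d1 s).fun_add (d2 s)).fun_sub (d3 s)).fun_add (d4 s)]
    refine Finset.sum_congr rfl fun s _ => ?_
    rw [pd_add (((d1 s).fun_add (d2 s)).fun_sub (d3 s)) (d4 s),
      pd_sub ((d1 s).fun_add (d2 s)) (d3 s), pd_add (d1 s) (d2 s), pd_const_mul (hwd j k s),
      pd_mul (haff s j) (hbd p k s), pd_mul (haff s k) (hbd p j s), pd_affineTensor,
      pd_affineTensor]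
    have : (fun u => mokhovMetric η h s p u * c j k s)
        = fun u => c j k s * mokhovMetric η h s p u := funext fun u => mul_comm _ _
    rw [this, pd_const_mul (hgd s p), hpdg]
    ring
  have hbw : ∀ l i j, Op.bwM (darbouxOp η c f) (mokhovOp η h w) l i j r u
      = ∑ s, mokhovConn η h s l r u * c i j s := by
    intro l i j
    refine Finset.sum_congr rfl fun s _ => ?_
    simp only [darbouxOp, pd_affineTensor, mokhovOp]
    ring
  have hS : ∑ q, η p q * tensorS c f h w j k q r u
      = (∑ q, η p q * pd q (pd r (w j k)) u)
        + ∑ s, ((∑ q, η p q * pd q (pd r (h s)) u) * c j k s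
          + (∑ q, η p q * pd q (pd s (h k)) u) * c s j r
          + (∑ q, η p q * c s j q) * pd s (pd r (h k)) u
          - (∑ q, η p q * c s k q) * pd s (pd r (h j)) u
          - (∑ q, η p q * pd q (pd s (h j)) u) * c s k r
          - (∑ q, η p q * pd q (pd s (pd r (h j))) u) * affineTensor c f s k u
          - (∑ q, η p q * pd q (pd s (pd r (h k))) u) * affineTensor c f j s u) := by
    have ha : ∀ i j, ∑ m, c i j m * u m + f i j = affineTensor c f i j u := fun i j => rfl
    simp only [tensorS, ha]
    simp only [mul_add, Finset.sum_add_distrib (s := Finset.univ (α := Fin n)) (f := fun q =>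
      η p q * pd q (pd r (w j k)) u), Finset.mul_sum]
    rw [Finset.sum_comm]
    congr 1
    simp only [Finset.sum_mul, ← Finset.sum_add_distrib, ← Finset.sum_sub_distrib]
    exact Finset.sum_congr rfl fun s _ => Finset.sum_congr rfl fun q _ => by ring
  have hthird : ∀ j s, ∑ q, η p q * pd q (pd s (pd r (h j))) u = pd r (mokhovConn η h p j s) u := by
    intro j s
    rw [pd_mokhovConn hU hh p j s r hu]
    refine Finset.sum_congr rfl fun q _ => ?_
    rw [pd_comm₃ hU (hh j) q s r hu, pd_congr hU (fun u hu => pd_comm hU (hh j) s q hu) r hu]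
  have hwc : ∑ q, η p q * pd q (pd r (w j k)) u = ∑ s, η s p * pd r (pd s (w j k)) u :=
    Finset.sum_congr rfl fun q _ => by rw [hη.apply q p, pd_comm hU (hw j k) q r hu]
  -- Antisymmetry replaces the `η` contracted with `c` by one contracted with the second derivatives
  -- of `h`, which assembles `b^{sk}_r`.
  have hswap : ∀ j k, ∑ s, (∑ q, η p q * c s j q) * pd s (pd r (h k)) u
      = - ∑ s, mokhovConn η h s k r u * c p j s := by
    intro j k
    simp only [hanti p _ j, mokhovConn, Finset.sum_mul, neg_mul, Finset.sum_neg_distrib]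
    rw [Finset.sum_comm]
    congr 1
    exact Finset.sum_congr rfl fun s _ => Finset.sum_congr rfl fun t _ => by ring
  have hc' : ∀ i j s, ∑ l, η i l * pd l (pd s (h j)) u = mokhovConn η h i j s u := fun i j s => rfl
  rw [hS, hwc]
  simp only [hthird, hc']
  simp only [Finset.sum_add_distrib, Finset.sum_sub_distrib, hswap]
  rw [hpd, hbw, hbw, hbw]
  have e1 : ∑ s, mokhovConn η h s j r u * c k p s = - ∑ s, mokhovConn η h s j r u * c p k s := by
    rw [← Finset.sum_neg_distrib]
    exact Finset.sum_congr rfl fun s _ => by rw [hcskew k p]; ring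
  have e2 : ∑ s, pd r (mokhovConn η h p k s) u * affineTensor c f j s u
      = - ∑ s, affineTensor c f s j u * pd r (mokhovConn η h p k s) u := by
    rw [← Finset.sum_neg_distrib]
    exact Finset.sum_congr rfl fun s _ => by rw [hskew j s]; ring
  have e3 : ∑ s, pd r (mokhovConn η h p j s) u * affineTensor c f s k u
      = ∑ s, affineTensor c f s k u * pd r (mokhovConn η h p j s) u :=
    Finset.sum_congr rfl fun s _ => mul_comm _ _
  rw [e1, e2, e3]
  simp only [Finset.sum_add_distrib, Finset.sum_sub_distrib, add_mul]
  ring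

/-- Interchanging the last two indices swaps the two `ω b` terms and reverses the sign of the
differentiated `ω` by its skewness. -/
theorem phiM_skew (cA : (darbouxOp η c f).PointConditions U)
    (cB : (mokhovOp η h w).PointConditions U) (hU : IsOpen U)
    (hw : ∀ i j, ContDiffOn ℝ ∞ (w i j) U) {u : Fin n → ℝ} (hu : u ∈ U) (j l i : Fin n) :
    Op.phiM (darbouxOp η c f) (mokhovOp η h w) j l i u
      = - Op.phiM (darbouxOp η c f) (mokhovOp η h w) j i l u := by
  have key : ∀ {a : Fin n → Fin n → (Fin n → ℝ) → ℝ}, (∀ i j, ContDiffOn ℝ ∞ (a i j) U) →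
      (∀ u ∈ U, ∀ i j, a i j u + a j i u = 0) → ∀ i j s, pd s (a i j) u = - pd s (a j i) u := by
    intro a ha hs i j s
    have h1 := pd_congr hU (fun u hu => hs u hu i j) s hu
    rw [pd_add ((ha i j).differentiableAt_of_isOpen hU hu)
      ((ha j i).differentiableAt_of_isOpen hU hu), pd_const] at h1
    linarith
  have h1 := key (a := (darbouxOp η c f).w)
    (fun i j => (contDiff_affineTensor c f i j).contDiffOn) cA.w_skew
  have h2 := key (a := (mokhovOp η h w).w) hw cB.w_skew
  simp only [Op.phiM, ← Finset.sum_neg_distrib]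
  refine Finset.sum_congr rfl fun s _ => ?_
  rw [h1 l i, h2 l i]
  ring

/-- The Hamiltonian property of the first-order part. -/
theorem pointConditions_mokhovOp_zero
    (hG : ∀ u ∈ U, ∀ i j k, tensorG η h i j k u = 0)
    (hR : ∀ u ∈ U, ∀ j r s k, tensorR η h j r s k u = 0) :
    (mokhovOp η h fun _ _ _ => 0).PointConditions U where
  w_skew u hu i j := by simp [mokhovOp]
  gb_symm u hu l j i := sub_eq_zero.1 ((tensorG_eq l j i u).symm.trans (hG u hu l j i))
  bb_symm u hu j l i k := by
    have h1 := sum_mul_tensorR (η := η) (h := h) (w := fun _ _ _ => 0) j i l k u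
    simp only [hR u hu, mul_zero, Finset.sum_const_zero] at h1
    exact sub_eq_zero.1 h1.symm
  phi_cyclic u hu j l i := by simp [Op.phi, mokhovOp, pd_const]
  pd_phi u hu i j l k := by
    have : (mokhovOp η h fun _ _ _ => 0).phi i j l = fun _ => 0 := by
      funext u; simp [Op.phi, mokhovOp, pd_const]
    rw [this, pd_const]
    simp [Op.bw, mokhovOp, pd_const]
  ww_cyclic u hu i j l := by simp [Op.ww, mokhovOp]

/-- `phiM` is always skew in its last two indices, and `P = 0` says that it is skew in the first
two. For such a tensor this is equivalent to cyclic invariance. `S` and `L` encode `pd_phi` and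
`ww_cyclic`. -/
theorem mixedConditions_iff (hU : IsOpen U) (hη : η.IsSymm) (hdet : η.det ≠ 0)
    (hh : ∀ i, ContDiffOn ℝ ∞ (h i) U) (hw : ∀ i j, ContDiffOn ℝ ∞ (w i j) U)
    (cA : (darbouxOp η c f).PointConditions U) (cB : (mokhovOp η h w).PointConditions U) :
    Op.MixedConditions (darbouxOp η c f) (mokhovOp η h w) U ↔
      (∀ u ∈ U, ∀ i j k, tensorL c f w i j k u = 0) ∧
      (∀ u ∈ U, ∀ i j k, tensorP η c f h w i j k u = 0) ∧
      (∀ u ∈ U, ∀ j k i r, tensorS c f h w j k i r u = 0) := by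
  have hskew : ∀ u ∈ U, ∀ i j, affineTensor c f i j u = - affineTensor c f j i u :=
    fun u hu i j => eq_neg_of_add_eq_zero_left (cA.w_skew u hu i j)
  have hP := fun {u} (hu : u ∈ U) =>
    tensorP_eq (h := h) (w := w) hη (hskew u hu)
  have hS := fun {u} (hu : u ∈ U) => sum_mul_tensorS hU hη hh hw cA hu
  have hanti := fun {u} (hu : u ∈ U) => phiM_skew cA cB hU hw hu
  constructor
  · intro cM
    refine ⟨fun u hu i j k => ?_, fun u hu i j k => ?_, fun u hu j k i r => ?_⟩
    · rw [tensorL_eq (η := η) (h := h), cM.ww_cyclic u hu]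
    · rw [hP hu, cM.phi_cyclic u hu j i k, hanti hu i k j, add_neg_cancel]
    · have h0 : (fun q => tensorS c f h w j k q r u) = 0 := by
        refine eq_zero_of_sum_mul_eq_zero hdet fun p => ?_
        rw [hS hu, cM.pd_phi u hu, sub_self]
      exact congrFun h0 i
  · rintro ⟨hL, hP0, hS0⟩
    refine ⟨fun u hu l j i => ?_, fun u hu j l i k => ?_, fun u hu j l i => ?_,
      fun u hu i j l k => ?_, fun u hu i j l => ?_⟩
    -- As `A` has constant `g` and no `b`, the expression is `η^{sl} η^{jt} ∂_t ∂_s h^i`, symmetric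
    -- in `l` and `j` by equality of mixed partials.
    · simp only [Op.gbM, darbouxOp, mokhovOp, mokhovConn, mul_zero, add_zero, Finset.mul_sum]
      rw [Finset.sum_comm]
      refine Finset.sum_congr rfl fun s _ => Finset.sum_congr rfl fun t _ => ?_
      rw [hη.apply l t, hη.apply j s, pd_comm hU (hh i) s t hu]
      ring
    · simp [Op.bbM, darbouxOp]
    · have h1 := hP hu j l i
      rw [hP0 u hu] at h1
      have h2 := hanti hu l j i
      linarith
    · have h1 := hS hu i j l k
      simp only [hS0 u hu, mul_zero, Finset.sum_const_zero] at h1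
      linarith
    · rw [← tensorL_eq, hL u hu]

end

end HydroPair

end

theorem mainTheorem3 (n : ℕ) (U : Set (Fin n → ℝ)) (hU : IsOpen U)
    (η : Matrix (Fin n) (Fin n) ℝ) (hη_symm : η.IsSymm) (hη_det : η.det ≠ 0)
    (c : Fin n → Fin n → Fin n → ℝ) (f : Fin n → Fin n → ℝ)
    (h : Fin n → (Fin n → ℝ) → ℝ) (hh : ∀ i, ContDiffOn ℝ ∞ (h i) U)
    (w : Fin n → Fin n → (Fin n → ℝ) → ℝ) (hw : ∀ i j, ContDiffOn ℝ ∞ (w i j) U)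
    (hA : (HydroPair.darbouxOp η c f).IsHamiltonian U)
    (hB : (HydroPair.mokhovOp η h w).firstOrder.IsHamiltonian U →
      (HydroPair.mokhovOp η h w).IsHamiltonian U) :
    HydroPair.Op.Compatible U (HydroPair.darbouxOp η c f) (HydroPair.mokhovOp η h w) ↔
      (∀ u ∈ U, ∀ i j k, HydroPair.tensorG η h i j k u = 0) ∧
      (∀ u ∈ U, ∀ j r s k, HydroPair.tensorR η h j r s k u = 0) ∧
      (∀ u ∈ U, ∀ i j k, HydroPair.tensorL c f w i j k u = 0) ∧
      (∀ u ∈ U, ∀ i j k, HydroPair.tensorP η c f h w i j k u = 0) ∧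
      (∀ u ∈ U, ∀ j k i r, HydroPair.tensorS c f h w j k i r u = 0) := by
  have rA : (HydroPair.darbouxOp η c f).IsRegular U := HydroPair.isRegular_darbouxOp hη_symm
  have rB : (HydroPair.mokhovOp η h w).IsRegular U := HydroPair.isRegular_mokhovOp hU hh hw
  have r0 : (HydroPair.mokhovOp η h fun _ _ _ => 0).IsRegular U :=
    HydroPair.isRegular_mokhovOp hU hh fun _ _ => contDiffOn_const
  have cA := (rA.isHamiltonian_iff_pointConditions hU).1 hA
  rw [HydroPair.Op.compatible_iff hU rA rB cA]
  constructor
  · rintro ⟨cB, cM⟩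
    refine ⟨fun u hu i j k => ?_, fun u hu j r s k => ?_,
      (HydroPair.mixedConditions_iff hU hη_symm hη_det hh hw cA cB).1 cM⟩
    · rw [HydroPair.tensorG_eq (w := w), cB.gb_symm u hu, sub_self]
    · have h0 : (fun q => HydroPair.tensorR η h j r q k u) = 0 := by
        refine HydroPair.eq_zero_of_sum_mul_eq_zero hη_det fun p => ?_
        rw [HydroPair.sum_mul_tensorR (w := w), cB.bb_symm u hu, sub_self]
      exact congrFun h0 s
  · rintro ⟨hG, hR, hLPS⟩
    -- `firstOrder` of `B` unfolds to the same Mokhov form with `w = 0`. It is Hamiltonian once `G =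
    -- R = 0`, and `hB` passes this on to `B`.
    have cB := (rB.isHamiltonian_iff_pointConditions hU).1
      (hB ((r0.isHamiltonian_iff_pointConditions hU).2
        (HydroPair.pointConditions_mokhovOp_zero hG hR)))
    exact ⟨cB, (HydroPair.mixedConditions_iff hU hη_symm hη_det hh hw cA cB).2 hLPS⟩
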